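/- Let $\mathbb T=\mathbb R/\mathbb Z$, let $\mathcal P(\mathbb T)$ be the set of Borel probability measures on $\mathbb T$, and let $q_u\in\mathcal P(\mathbb T)$ be the uniform distribution (density $1$). For $q\in\mathcal P(\mathbb T)$ let $H(q\mid q_u)=\int\log\frac{dq}{dq_u}\,dq\in[0,\infty]$ be the relative entropy ($+\infty$ if $q$ is not absolutely continuous). Let $W:\mathbb T\to\mathbb R$ be an integrable, even Borel function with zero average and Fourier coefficients $\widehat W(k)=\int_{\mathbb T}W(\theta)\cos(2\pi k\theta)\,d\theta$, and put $\mathcal E(q)=\iint W(\theta-\theta')\,dq(\theta)\,dq(\theta')\in[-\infty,\infty]$ (integral of the positive part minus integral of the negative part, with $\infty-\infty:=-\infty$). Suppose that: * $W$ has a positive-definite part $W^+$, i.e. an integrable function with $\widehat{W^+}(k)=\max(\widehat W(k),0)$ for all $k\in\mathbb Z$, and for every $K\ge0$ there is $C_K\ge0$ with $K\iint \max(W^+(\theta-\theta'),0)\,dq(\theta)\,dq(\theta')\le H(q\mid q_u)+C_K$ for all $q\in\mathcal P(\mathbb T)$; * for every $C\ge 0$, $\mathcal E$ is upper semicontinuous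 on $\{q: H(q\mid q_u)\le C\}$ for weak convergence of probability measures. For $K\ge0$ define the free energy $\mathcal F_K(q)=H(q\mid q_u)-K\,\mathcal E(q)\in(-\infty,\infty]$ if $H(q\mid q_u)<\infty$ (with $0\cdot(\pm\infty)=0$) and $\mathcal F_K(q)=+\infty$ otherwise. A critical point of $\mathcal F_K$ is a $q\in\mathcal P(\mathbb T)$ with $\mathcal F_K(q)<\infty$ that solves the Kirkwood–Monroe equation: $Z=\int_{\mathbb T}e^{2K(W*q)}\,d\theta<\infty$ and $q$ has density $Z^{-1}e^{2K(W*q)}$. **Theorem 1.1.** Let $n\ge0$ be an integer and suppose in addition that $W$ is $\frac1{n+1}$-periodic, $2\widehat W(n+1)=1$, and $2\widehat W(k)\le\frac{n+1}{k}$ for all $k\ge1$. Then: 1. For $K\ge0$, $q_u$ is the unique global minimizer of $\mathcal F_K$ on $\mathcal P(\mathbb T)$ if and only if $K\le1$. 2. The critical coupling strength is $K_c=1$: $q_u$ is the unique global minimizer of $\mathcal F_K$ for $0\le K<1$, it is a global minimizer for $K=1$, and for every $K>1$ there is a global minimizer $q\ne q_u$ of $\mathcal F_K$. It equals the linear stability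 threshold: $K_\#:=\big(2\max\{\widehat W(k):k\ge1,\ \widehat W(k)>0\}\big)^{-1}=1$, the maximum being attained. 3. The phase transition is continuous: $\mathcal F_1$ has a unique global minimizer, and for any choice of global minimizers $q_K$ of $\mathcal F_K$, $K>1$, one has $\limsup_{K\downarrow1}\|q_K-q_u\|_{L^1}=0$. 4. If $0\le K\le\frac12$, then $q_u$ is the unique critical point of $\mathcal F_K$. -/

import Mathlib

open MeasureTheory Filter Topology InformationTheory
open scoped NNReal ENNReal

noncomputable section

/-- The uniform distribution `q_u` on the circle `𝕋 = ℝ/ℤ`: normalised Haar (Lebesgue) measure. -/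
def uniformDist : ProbabilityMeasure UnitAddCircle :=
  ⟨AddCircle.haarAddCircle, inferInstance⟩

/-- The relative entropy `H(q | q_u) = ∫ log (q/q_u) dq ∈ [0, ∞]`; it is `∞` when `q` is not
absolutely continuous. -/
def relEntropy (q : ProbabilityMeasure UnitAddCircle) : ℝ≥0∞ :=
  klDiv (q : Measure UnitAddCircle) (uniformDist : Measure UnitAddCircle)

/-- The `k`-th Fourier coefficient `∫ W(θ) cos(2πkθ) dθ` of an even real function on the circle
(the imaginary part vanishes by evenness). -/
def WHat (W : UnitAddCircle → ℝ) (k : ℤ) : ℝ :=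
  (fourierCoeff (fun θ => (W θ : ℂ)) k).re

/-- `V` is the positive-definite part `W⁺` of `W`: the integrable function whose Fourier
coefficients are the positive parts of those of `W`. It is unique up to null sets. -/
def IsPositiveDefinitePart (W V : UnitAddCircle → ℝ) : Prop :=
  Measurable V ∧ Integrable V (uniformDist : Measure UnitAddCircle) ∧
    ∀ k : ℤ, fourierCoeff (fun θ => (V θ : ℂ)) k = ((max (WHat W k) 0 : ℝ) : ℂ)

/-- The interaction energy `∬ W(θ - θ') dq(θ) dq(θ')`, as an extended Lebesgue integral: the
integral of the positive part minus that of the negative part. (In `EReal`, `⊤ - ⊤ = ⊥`.) -/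
def interactionEnergy (W : UnitAddCircle → ℝ) (q : ProbabilityMeasure UnitAddCircle) : EReal :=
  ((∫⁻ p, ENNReal.ofReal (W (p.1 - p.2))
      ∂((q : Measure UnitAddCircle).prod (q : Measure UnitAddCircle)) : ℝ≥0∞) : EReal) -
  ((∫⁻ p, ENNReal.ofReal (-W (p.1 - p.2))
      ∂((q : Measure UnitAddCircle).prod (q : Measure UnitAddCircle)) : ℝ≥0∞) : EReal)

open Classical in
/-- The free energy `F_K(q) = ∫ log q dq - K ∬ W(θ - θ') dq(θ) dq(θ')`, equal to `+∞` where the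
entropy is infinite. -/
def freeEnergy (W : UnitAddCircle → ℝ) (K : ℝ) (q : ProbabilityMeasure UnitAddCircle) : EReal :=
  if relEntropy q = ⊤ then ⊤
  else (relEntropy q : EReal) - (K : EReal) * interactionEnergy W q

/-- The standing assumptions on an interaction potential: an integrable, even, mean-zero Borel
function such that the positive part of `W⁺` is controlled by the entropy for every coupling and
the interaction energy is upper semicontinuous on sets of bounded entropy, for weak convergence of
probability measures. -/
structure IsInteraction (W : UnitAddCircle → ℝ) : Prop where
  measurable : Measurable W
  integrable : Integrable W (uniformDist : Measure UnitAddCircle)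
  even : ∀ θ, W (-θ) = W θ
  mean_zero : ∫ θ, W θ ∂(uniformDist : Measure UnitAddCircle) = 0
  lower_bound : ∃ V : UnitAddCircle → ℝ, IsPositiveDefinitePart W V ∧
    ∀ K : ℝ≥0, ∃ C : ℝ≥0, ∀ q : ProbabilityMeasure UnitAddCircle,
      (K : ℝ≥0∞) * ∫⁻ p, ENNReal.ofReal (V (p.1 - p.2))
          ∂((q : Measure UnitAddCircle).prod (q : Measure UnitAddCircle))
        ≤ relEntropy q + (C : ℝ≥0∞)
  usc : ∀ C : ℝ≥0, UpperSemicontinuousOn (interactionEnergy W) {q | relEntropy q ≤ (C : ℝ≥0∞)}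

/-- `q` is a global minimizer of `F_K` on the probability measures of the circle. -/
def IsGlobalMinimizer (W : UnitAddCircle → ℝ) (K : ℝ) (q : ProbabilityMeasure UnitAddCircle) :
    Prop :=
  ∀ p : ProbabilityMeasure UnitAddCircle, freeEnergy W K q ≤ freeEnergy W K p

/-- `q` is the one and only global minimizer of `F_K`. -/
def IsUniqueGlobalMinimizer (W : UnitAddCircle → ℝ) (K : ℝ)
    (q : ProbabilityMeasure UnitAddCircle) : Prop :=
  IsGlobalMinimizer W K q ∧ ∀ p, IsGlobalMinimizer W K p → p = q

/-- `K_c` is the critical coupling strength of the phase transition. -/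
structure IsCriticalCoupling (W : UnitAddCircle → ℝ) (Kc : ℝ) : Prop where
  pos : 0 < Kc
  subcritical : ∀ K, 0 ≤ K → K < Kc → IsUniqueGlobalMinimizer W K uniformDist
  critical : IsGlobalMinimizer W Kc uniformDist
  supercritical : ∀ K, Kc < K → ∃ q, q ≠ uniformDist ∧ IsGlobalMinimizer W K q

/-- The `L¹` distance between the Lebesgue density of `q` and the uniform density `1`. -/
def l1DistUniform (q : ProbabilityMeasure UnitAddCircle) : ℝ≥0∞ :=
  eLpNorm (fun θ => ((q : Measure UnitAddCircle).rnDeriv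
    (uniformDist : Measure UnitAddCircle) θ).toReal - 1) 1 (uniformDist : Measure UnitAddCircle)

/-- The phase transition at `K_c` is continuous: the global minimizer at `K_c` is unique, and every
family of global minimizers for `K > K_c` tends to the uniform distribution in `L¹` as `K ↓ K_c`.
(Global minimizers for `K > K_c` have finite free energy, hence a density.) -/
def IsContinuousTransition (W : UnitAddCircle → ℝ) (Kc : ℝ) : Prop :=
  (∃! q, IsGlobalMinimizer W Kc q) ∧
    ∀ q : ℝ → ProbabilityMeasure UnitAddCircle, (∀ K, Kc < K → IsGlobalMinimizer W K (q K)) →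
      limsup (fun K => l1DistUniform (q K)) (𝓝[>] Kc) = 0

/-- `K` is the linear stability threshold `K_# = 1 / (2 max {Ŵ(k) : k ≥ 1, Ŵ(k) > 0})` of the
uniform distribution. -/
def IsLinearStabilityThreshold (W : UnitAddCircle → ℝ) (K : ℝ) : Prop :=
  ∃ m : ℝ, IsGreatest {x | ∃ k : ℕ, 1 ≤ k ∧ 0 < WHat W k ∧ x = WHat W k} m ∧ K = 1 / (2 * m)

/-- The convolution `(W * q)(θ) = ∫ W(θ - θ') dq(θ')`, defined for almost every `θ`. -/
def convMeasure (W : UnitAddCircle → ℝ) (q : ProbabilityMeasure UnitAddCircle)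
    (θ : UnitAddCircle) : ℝ :=
  ∫ θ', W (θ - θ') ∂(q : Measure UnitAddCircle)

/-- `q` is a critical point of `F_K`: it lies in the effective domain of `F_K` and solves the
Kirkwood-Monroe equation `q = Z⁻¹ exp(2K W * q)`, with `Z = ∫ exp(2K W * q) < ∞`. -/
def IsCriticalPoint (W : UnitAddCircle → ℝ) (K : ℝ) (q : ProbabilityMeasure UnitAddCircle) :
    Prop :=
  freeEnergy W K q < ⊤ ∧
  Integrable (fun θ => Real.exp (2 * K * convMeasure W q θ))
    (uniformDist : Measure UnitAddCircle) ∧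
  (q : Measure UnitAddCircle) = (uniformDist : Measure UnitAddCircle).withDensity (fun θ =>
    ENNReal.ofReal (Real.exp (2 * K * convMeasure W q θ) /
      ∫ η, Real.exp (2 * K * convMeasure W q η) ∂(uniformDist : Measure UnitAddCircle)))

end

/-! Write m = n + 1. A 1/m-periodic, mean-zero W only has frequencies jm with j ≠ 0, so for a
bounded density Parseval gives E(q) = ∑_{j≥1} 2Ŵ(jm)|q̂(jm)|², and the decay hypothesis bounds this
by ∑ |q̂(jm)|²/j. The heart of the proof is the logarithmic Hardy-Littlewood-Sobolev inequality ∑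
|q̂(jm)|²/j ≤ H(q | q_u) (`logEnergy_le`). It is dual to the Lebedev-Milin inequality ∫ exp(2 Re g)
≤ exp(∑ j|a_j|²), g = ∑ a_j e(jmθ) (`integral_exp_trigPoly_le`): insert a_j = q̂(jm)/j into the
Donsker-Varadhan inequality. General q of finite entropy follow by conditioning on sublevel sets of
the density. Hence E ≤ H, and F_K ≥ 0 for 0 ≤ K ≤ 1.

For uniqueness, Lebedev-Milin is proved coefficient by coefficient. Each deficit is at most a
constant times H − E, a bound that survives the approximation, so E = H forces q̂(jm) = q̂(m)^j as
well as (1/j − 2Ŵ(jm))|q̂(jm)|² = 0 (`equality_case`). If q̂(m) ≠ 0, then 2Ŵ(jm) = 1/j for all j: W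
is the logarithmic kernel, whose energy on short arcs violates the entropy bound on W⁺
(`exists_two_mul_WHat_ne`). So q̂(m) = 0, the energy vanishes, and with it the entropy.

Above K = 1 the density 1 + ε cos(2πmθ) has energy ε²/4 and entropy at most ε²/4 + O(ε³), hence
negative free energy; minimizers exist by compactness and lower semicontinuity. As K ↓ 1 any cluster
point of minimizers has F_1 ≤ 0 and is therefore uniform, so their energies tend to 0; since H ≤ K
E, so do their entropies, and a Pinsker-type bound gives L¹ convergence.

A critical point satisfies H = 2K E − log Z. With E ≤ H and 2K ≤ 1 this gives Z ≤ 1, while u = 2K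
W*q has mean zero and exp u ≥ 1 + u, so Z ≥ 1 with equality only for u = 0 almost everywhere. -/

noncomputable section

local notation "μ₀" => (AddCircle.haarAddCircle : Measure UnitAddCircle)

/-! ### Lebedev-Milin inequality for power series coefficients -/

/-- The Taylor coefficients of `exp (∑ k ≥ 1, a k * z ^ k)`. -/
def expCoeff {𝕜 : Type*} [Field 𝕜] (a : ℕ → 𝕜) : ℕ → 𝕜
  | 0 => 1
  | n + 1 => (∑ i : Fin (n + 1), ((i : 𝕜) + 1) * a (i + 1) * expCoeff a (n - i)) / ((n : 𝕜) + 1)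

/-- This is f' = g' f for f = exp g, read off coefficient by coefficient. Taking it as the
definition serves real and complex sequences alike and needs no convergence. -/
lemma expCoeff_succ {𝕜 : Type*} [Field 𝕜] (a : ℕ → 𝕜) (n : ℕ) :
    expCoeff a (n + 1) = (∑ i ∈ Finset.range (n + 1),
      ((i : 𝕜) + 1) * a (i + 1) * expCoeff a (n - i)) / ((n : 𝕜) + 1) := by
  rw [expCoeff, Finset.sum_range]

lemma expCoeff_congr {𝕜 : Type*} [Field 𝕜] {a b : ℕ → 𝕜} {N : ℕ} (h : ∀ k ≤ N, a k = b k) :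
    ∀ k ≤ N, expCoeff a k = expCoeff b k := by
  intro k
  induction k using Nat.strong_induction_on with
  | _ k ih =>
    intro hk
    cases k with
    | zero => simp [expCoeff]
    | succ k =>
      rw [expCoeff_succ, expCoeff_succ]
      congr 1
      refine Finset.sum_congr rfl fun i hi => ?_
      have := Finset.mem_range.1 hi
      rw [h (i + 1) (by omega), ih (k - i) (by omega) (by omega)]

lemma ofReal_expCoeff (b : ℕ → ℝ) (k : ℕ) :
    ((expCoeff b k : ℝ) : ℂ) = expCoeff (fun k => (b k : ℂ)) k := by
  induction k using Nat.strong_induction_on with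
  | _ k ih =>
    cases k with
    | zero => simp [expCoeff]
    | succ k =>
      rw [expCoeff_succ, expCoeff_succ]
      push_cast
      congr 1
      refine Finset.sum_congr rfl fun i hi => ?_
      rw [ih (k - i) (by omega)]

/-- Each coefficient is a polynomial in finitely many `a k`. This carries the Lebedev-Milin deficit
to the limit along approximating measures. -/
lemma tendsto_expCoeff {ι 𝕜 : Type*} [RCLike 𝕜] {l : Filter ι} {a : ι → ℕ → 𝕜} {b : ℕ → 𝕜}
    (h : ∀ k, Tendsto (fun i => a i k) l (𝓝 (b k))) (k : ℕ) :
    Tendsto (fun i => expCoeff (a i) k) l (𝓝 (expCoeff b k)) := by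
  induction k using Nat.strong_induction_on with
  | _ k ih =>
    cases k with
    | zero => simpa [expCoeff] using tendsto_const_nhds
    | succ k =>
      simp only [expCoeff_succ]
      refine Tendsto.div_const (tendsto_finsetSum _ fun j hj => ?_) _
      exact (tendsto_const_nhds.mul (h (j + 1))).mul (ih (k - j) (by omega))

/-- The norm of a sum and the Cauchy-Schwarz inequality in the form
`‖∑ x i‖² ≤ #s * ∑ ‖x i‖²`. -/
lemma norm_sum_sq_le {ι : Type*} (s : Finset ι) (x : ι → ℂ) :
    ‖∑ i ∈ s, x i‖ ^ 2 ≤ s.card * ∑ i ∈ s, ‖x i‖ ^ 2 :=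
  (pow_le_pow_left₀ (norm_nonneg _) (norm_sum_le _ _) 2).trans sq_sum_le_card_mul_sum_sq

/-- Lagrange's identity for Cauchy-Schwarz against the constant vector; it makes the equality case
visible. -/
lemma card_mul_sum_norm_sq_sub {ι : Type*} (s : Finset ι) (x : ι → ℂ) :
    ∑ i ∈ s, ∑ j ∈ s, ‖x i - x j‖ ^ 2
      = 2 * (s.card * ∑ i ∈ s, ‖x i‖ ^ 2 - ‖∑ i ∈ s, x i‖ ^ 2) := by
  have key : ∀ z w : ℂ, ‖z - w‖ ^ 2
      = ‖z‖ ^ 2 + ‖w‖ ^ 2 - 2 * (z * (starRingEnd ℂ) w).re := by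
    intro z w
    simp only [← Complex.normSq_eq_norm_sq, Complex.normSq_sub]
  simp only [key, Finset.sum_sub_distrib, Finset.sum_add_distrib, Finset.sum_const, nsmul_eq_mul,
    ← Finset.mul_sum]
  have : ‖∑ i ∈ s, x i‖ ^ 2 = ∑ i ∈ s, ∑ j ∈ s, (x i * (starRingEnd ℂ) (x j)).re := by
    rw [← Complex.normSq_eq_norm_sq, ← Complex.ofReal_re (Complex.normSq _), ← Complex.mul_conj,
      map_sum, Finset.sum_mul_sum]
    simp
  rw [this]
  ring

lemma eq_of_norm_sum_sq_eq {ι : Type*} {s : Finset ι} {x : ι → ℂ}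
    (h : ‖∑ i ∈ s, x i‖ ^ 2 = s.card * ∑ i ∈ s, ‖x i‖ ^ 2) {i j : ι} (hi : i ∈ s) (hj : j ∈ s) :
    x i = x j := by
  have h0 := card_mul_sum_norm_sq_sub s x
  rw [h, sub_self, mul_zero, Finset.sum_eq_zero_iff_of_nonneg
    (fun i _ => Finset.sum_nonneg fun j _ => by positivity)] at h0
  have h1 := (Finset.sum_eq_zero_iff_of_nonneg (fun j _ => by positivity)).1 (h0 i hi) j hj
  exact sub_eq_zero.1 (norm_eq_zero.1 (pow_eq_zero_iff (two_ne_zero) |>.1 h1))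

/-- The squares in the Lebedev-Milin inequality. -/
def lebedevMilinWeight (a : ℕ → ℂ) (k : ℕ) : ℝ := k * ‖a k‖ ^ 2

/-- **Lebedev-Milin inequality**, coefficientwise form. -/
lemma norm_sq_expCoeff_le (a : ℕ → ℂ) (k : ℕ) :
    ‖expCoeff a k‖ ^ 2 ≤ expCoeff (lebedevMilinWeight a) k := by
  induction k using Nat.strong_induction_on with
  | _ k ih =>
    cases k with
    | zero => simp [expCoeff]
    | succ k =>
      rw [expCoeff_succ, expCoeff_succ, norm_div, div_pow]
      have hk : ‖((k : ℂ) + 1)‖ = (k : ℝ) + 1 := by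
        rw [← Nat.cast_succ, Complex.norm_natCast]; simp
      rw [hk, div_le_div_iff₀ (by positivity) (by positivity), pow_two ((k : ℝ) + 1), ← mul_assoc]
      refine mul_le_mul_of_nonneg_right ?_ (by positivity)
      -- The factor k + 1 lost in Cauchy-Schwarz is exactly one of the two factors in the squared
      -- denominator of the recursion.
      refine (norm_sum_sq_le _ _).trans ?_
      rw [Finset.card_range, mul_comm]
      push_cast
      refine mul_le_mul_of_nonneg_right (Finset.sum_le_sum fun i hi => ?_) (by positivity)
      have hi' : ‖((i : ℂ) + 1)‖ = (i : ℝ) + 1 := by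
        rw [← Nat.cast_succ, Complex.norm_natCast]; simp
      rw [norm_mul, norm_mul, mul_pow, mul_pow, hi', lebedevMilinWeight]
      have := ih (k - i) (by omega)
      calc ((i : ℝ) + 1) ^ 2 * ‖a (i + 1)‖ ^ 2 * ‖expCoeff a (k - i)‖ ^ 2
          ≤ ((i : ℝ) + 1) ^ 2 * ‖a (i + 1)‖ ^ 2 * expCoeff (lebedevMilinWeight a) (k - i) := by
            gcongr
        _ = _ := by push_cast; ring

/-- The equality case of the Lebedev-Milin inequality. -/
lemma eq_of_norm_sq_expCoeff_eq {a : ℕ → ℂ}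
    (h : ∀ k, ‖expCoeff a k‖ ^ 2 = expCoeff (lebedevMilinWeight a) k) (k : ℕ) :
    expCoeff a k = a 1 ^ k ∧ (1 ≤ k → (k : ℂ) * a k = a 1 ^ k) := by
  induction k using Nat.strong_induction_on with
  | _ k ih =>
    cases k with
    | zero => simp [expCoeff]
    | succ k =>
      have hk : ‖((k : ℂ) + 1)‖ = (k : ℝ) + 1 := by
        rw [← Nat.cast_succ, Complex.norm_natCast]; simp
      have hk0 : (k : ℝ) + 1 ≠ 0 := by positivity
      set x : ℕ → ℂ := fun i => ((i : ℂ) + 1) * a (i + 1) * expCoeff a (k - i) with hx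
      have key : ‖∑ i ∈ Finset.range (k + 1), x i‖ ^ 2
          = (Finset.range (k + 1)).card * ∑ i ∈ Finset.range (k + 1), ‖x i‖ ^ 2 := by
        have h1 := h (k + 1)
        rw [expCoeff_succ, expCoeff_succ, norm_div, div_pow, hk, pow_two ((k : ℝ) + 1),
          div_eq_div_iff (by positivity) (by positivity), ← mul_assoc] at h1
        have h2 := mul_right_cancel₀ hk0 h1
        rw [h2, Finset.card_range, mul_comm]
        push_cast
        congr 1
        refine Finset.sum_congr rfl fun i hi => ?_
        have hi' : ‖((i : ℂ) + 1)‖ = (i : ℝ) + 1 := by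
          rw [← Nat.cast_succ, Complex.norm_natCast]; simp
        rw [norm_mul, norm_mul, mul_pow, mul_pow, hi', lebedevMilinWeight, h (k - i)]
        push_cast
        ring
      -- Equality in Cauchy-Schwarz makes all summands equal. The summand i = 0 is a 1 * a 1 ^ k by
      -- induction; the summand i = k will be (k + 1) * a (k + 1).
      have heq : ∀ i ∈ Finset.range (k + 1), x i = a 1 ^ (k + 1) := by
        intro i hi
        rw [eq_of_norm_sum_sq_eq key hi (Finset.mem_range.2 (Nat.succ_pos k))]
        simp [hx, (ih k (by omega)).1, pow_succ, mul_comm]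
      have hkc : (k : ℂ) + 1 ≠ 0 := by exact_mod_cast Nat.succ_ne_zero k
      constructor
      · rw [expCoeff_succ, Finset.sum_congr rfl heq]
        simp
        field_simp
      · intro _
        have := heq k (by simp)
        simpa [hx, expCoeff] using this

/-! ### Taylor series of exponentials of polynomials -/

/-- The truncation of a sequence after the index `N`. -/
def truncate {𝕜 : Type*} [Zero 𝕜] (a : ℕ → 𝕜) (N k : ℕ) : 𝕜 := if k ≤ N then a k else 0

/-- The polynomial `∑ 1 ≤ k ≤ N, a k * z ^ k`. -/
def partialPoly (a : ℕ → ℂ) (N : ℕ) : Polynomial ℂ :=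
  ∑ j ∈ Finset.range N, Polynomial.monomial (j + 1) (a (j + 1))

lemma eval_partialPoly (a : ℕ → ℂ) (N : ℕ) (z : ℂ) :
    (partialPoly a N).eval z = ∑ j ∈ Finset.range N, a (j + 1) * z ^ (j + 1) := by
  simp [partialPoly, Polynomial.eval_finsetSum]

lemma coeff_partialPoly (a : ℕ → ℂ) (N k : ℕ) :
    (partialPoly a N).coeff (k + 1) = truncate a N (k + 1) := by
  simp [partialPoly, Polynomial.coeff_monomial, truncate]

lemma iteratedDeriv_eval_zero (p : Polynomial ℂ) (k : ℕ) :
    iteratedDeriv k (fun z => p.eval z) 0 = k.factorial * p.coeff k := by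
  have : ∀ k, iteratedDeriv k (fun z => p.eval z)
      = fun z => (Polynomial.derivative^[k] p).eval z := by
    intro k
    induction k with
    | zero => simp
    | succ k ih =>
      rw [iteratedDeriv_succ, ih]
      funext z
      rw [Polynomial.deriv, Function.iterate_succ_apply']
  rw [this]
  simp only
  rw [← Polynomial.coeff_zero_eq_eval_zero, Polynomial.coeff_iterate_derivative]
  simp [Nat.descFactorial_self]

/-- Leibniz's rule applied to (exp p)' = p' exp p reproduces the recursion of `expCoeff`. -/
lemma iteratedDeriv_cexp_partialPoly (a : ℕ → ℂ) (N k : ℕ) :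
    iteratedDeriv k (fun z => Complex.exp ((partialPoly a N).eval z)) 0
      = k.factorial * expCoeff (truncate a N) k := by
  set p := partialPoly a N
  have hd : Differentiable ℂ fun z => Complex.exp (p.eval z) := p.differentiable.cexp
  induction k using Nat.strong_induction_on with
  | _ k ih =>
    cases k with
    | zero => simp [expCoeff, p, eval_partialPoly]
    | succ k =>
      have hderiv : deriv (fun z => Complex.exp (p.eval z))
          = (fun z => p.derivative.eval z) * fun z => Complex.exp (p.eval z) := by
        funext z
        rw [deriv_cexp p.differentiableAt, Polynomial.deriv]
        simp [mul_comm]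
      rw [iteratedDeriv_succ', hderiv,
        iteratedDeriv_mul p.derivative.differentiable.contDiff.contDiffAt
        hd.contDiff.contDiffAt, expCoeff_succ, Nat.factorial_succ]
      push_cast
      have hkc : (k : ℂ) + 1 ≠ 0 := by exact_mod_cast Nat.succ_ne_zero k
      rw [mul_comm ((k : ℂ) + 1), mul_assoc, mul_div_cancel₀ _ hkc, Finset.mul_sum]
      refine Finset.sum_congr rfl fun i hi => ?_
      have hik : i ≤ k := by simpa [Nat.lt_succ_iff] using hi
      rw [iteratedDeriv_eval_zero, ih (k - i) (by omega), Polynomial.coeff_derivative,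
        coeff_partialPoly]
      have := Nat.choose_mul_factorial_mul_factorial hik
      rw [← this]
      push_cast
      ring

lemma hasSum_expCoeff (a : ℕ → ℂ) (N : ℕ) (z : ℂ) :
    HasSum (fun k => expCoeff (truncate a N) k * z ^ k)
      (Complex.exp (∑ j ∈ Finset.range N, a (j + 1) * z ^ (j + 1))) := by
  have hd : Differentiable ℂ fun z => Complex.exp ((partialPoly a N).eval z) :=
    (partialPoly a N).differentiable.cexp
  have h := Complex.hasSum_taylorSeries_of_entire hd 0 z
  simp only [iteratedDeriv_cexp_partialPoly] at h
  simp only [eval_partialPoly, sub_zero, smul_eq_mul] at h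
  refine h.congr_fun fun k => ?_
  have : (k.factorial : ℂ) ≠ 0 := by exact_mod_cast k.factorial_ne_zero
  field_simp

lemma summable_norm_expCoeff (a : ℕ → ℂ) (N : ℕ) :
    Summable fun k => ‖expCoeff (truncate a N) k‖ := by
  have := (hasSum_expCoeff a N 1).summable
  simp only [one_pow, mul_one] at this
  exact this.norm

/-- The majorizing coefficients sum to an explicit exponential: evaluate their own generating
function at z = 1. -/
lemma hasSum_expCoeff_lebedevMilinWeight (a : ℕ → ℂ) (N : ℕ) :
    HasSum (expCoeff (lebedevMilinWeight (truncate a N)))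
      (Real.exp (∑ j ∈ Finset.range N, ((j : ℝ) + 1) * ‖a (j + 1)‖ ^ 2)) := by
  have h := hasSum_expCoeff (fun k => (lebedevMilinWeight a k : ℂ)) N 1
  have ht : truncate (fun k => (lebedevMilinWeight a k : ℂ)) N
      = fun k => (lebedevMilinWeight (truncate a N) k : ℂ) := by
    funext k
    unfold truncate lebedevMilinWeight
    by_cases hk : k ≤ N <;> simp [hk]
  rw [ht] at h
  simp only [one_pow, mul_one, ← ofReal_expCoeff] at h
  rw [← Complex.hasSum_ofReal]
  convert h using 1
  push_cast [lebedevMilinWeight]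
  rfl

/-! ### Lebedev-Milin inequality on the circle -/

lemma fourier_natCast_mul (k : ℕ) (m : ℤ) (θ : UnitAddCircle) :
    fourier ((k : ℤ) * m) θ = (fourier m θ) ^ k := by
  induction k with
  | zero => simp
  | succ k ih => rw [pow_succ, ← ih, ← fourier_add]; congr 2; push_cast; ring

lemma integral_fourier (k : ℤ) : ∫ θ, fourier k θ ∂μ₀ = if k = 0 then 1 else 0 := by
  have h := congrFun (fourierCoeff_fourier (T := (1 : ℝ)) k) 0
  rw [fourierCoeff] at h
  simp only [neg_zero, fourier_zero, one_smul] at h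
  rw [h, Pi.single_apply]
  simp [eq_comm]

/-- The real trigonometric polynomial `2 Re ∑ 1 ≤ j ≤ N, a j * e (j m θ)`. -/
def trigPoly (a : ℕ → ℂ) (m : ℤ) (N : ℕ) (θ : UnitAddCircle) : ℝ :=
  2 * (∑ j ∈ Finset.range N, a (j + 1) * (fourier m θ) ^ (j + 1)).re

lemma continuous_trigPoly (a : ℕ → ℂ) (m : ℤ) (N : ℕ) : Continuous (trigPoly a m N) := by
  unfold trigPoly; fun_prop

lemma exists_bound_trigPoly (a : ℕ → ℂ) (m : ℤ) (N : ℕ) : ∃ M, ∀ θ, |trigPoly a m N θ| ≤ M := by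
  obtain ⟨M, hM⟩ := isCompact_univ.exists_bound_of_continuousOn
    (continuous_trigPoly a m N).continuousOn
  exact ⟨M, fun θ => hM θ (Set.mem_univ _)⟩

lemma hasSum_integral_mul {c : ℕ → ℂ} (hc : Summable fun k => ‖c k‖) {h : ℕ → UnitAddCircle → ℂ}
    (hcont : ∀ k, Continuous (h k)) {B : ℝ} (hB : ∀ k θ, ‖h k θ‖ ≤ B) {G : UnitAddCircle → ℂ}
    (hG : ∀ θ, HasSum (fun k => c k * h k θ) (G θ)) :
    HasSum (fun k => c k * ∫ θ, h k θ ∂μ₀) (∫ θ, G θ ∂μ₀) := by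
  have := hasSum_integral_of_dominated_convergence (μ := μ₀)
    (F := fun k θ => c k * h k θ) (f := G) (bound := fun k _ => ‖c k‖ * B)
    (fun k => (continuous_const.mul (hcont k)).aestronglyMeasurable)
    (fun k => ae_of_all _ fun θ => by
      rw [norm_mul]; exact mul_le_mul_of_nonneg_left (hB k θ) (norm_nonneg _))
    (ae_of_all _ fun θ => hc.mul_right B) (integrable_const _) (ae_of_all _ hG)
  simpa only [integral_const_mul] using this

/-- Parseval for an absolutely convergent power series in e(mθ), whose powers are orthonormal
because m ≠ 0. -/
lemma hasSum_norm_sq_of_hasSum {c : ℕ → ℂ} (hc : Summable fun k => ‖c k‖) {m : ℤ} (hm : m ≠ 0)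
    {G : UnitAddCircle → ℂ} (hGc : Continuous G)
    (hG : ∀ θ, HasSum (fun k => c k * (fourier m θ) ^ k) (G θ)) :
    HasSum (fun k => ‖c k‖ ^ 2) (∫ θ, ‖G θ‖ ^ 2 ∂μ₀) := by
  obtain ⟨B, hB⟩ := isCompact_univ.exists_bound_of_continuousOn hGc.continuousOn
  have hn : ∀ (k : ℕ) (θ : UnitAddCircle), ‖(fourier m θ : ℂ) ^ k‖ = 1 := by
    intro k θ
    rw [norm_pow, fourier_apply, Circle.norm_coe, one_pow]
  have hcoeff : ∀ k : ℕ, ∫ θ, (fourier m θ : ℂ) ^ k * (starRingEnd ℂ) (G θ) ∂μ₀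
      = (starRingEnd ℂ) (c k) := by
    intro k
    have h1 := hasSum_integral_mul (c := fun l => (starRingEnd ℂ) (c l))
      (h := fun l θ => (fourier m θ : ℂ) ^ k * (starRingEnd ℂ) ((fourier m θ : ℂ) ^ l))
      (G := fun θ => (fourier m θ : ℂ) ^ k * (starRingEnd ℂ) (G θ)) (B := 1)
      (by simpa using hc) (fun l => by fun_prop)
      (fun l θ => by rw [norm_mul, RCLike.norm_conj, hn, hn, mul_one])
      (fun θ => by
        have := ((hG θ).map (starRingEnd ℂ) Complex.continuous_conj).mul_left
          ((fourier m θ : ℂ) ^ k)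
        refine this.congr_fun fun l => ?_
        simp only [Function.comp_apply, map_mul]
        ring)
    have h2 : ∀ l : ℕ, ∫ θ, (fourier m θ : ℂ) ^ k * (starRingEnd ℂ) ((fourier m θ : ℂ) ^ l) ∂μ₀
        = if l = k then 1 else 0 := by
      intro l
      have : ∀ θ : UnitAddCircle, (fourier m θ : ℂ) ^ k * (starRingEnd ℂ) ((fourier m θ : ℂ) ^ l)
          = fourier (((k : ℤ) - l) * m) θ := by
        intro θ
        rw [← fourier_natCast_mul, ← fourier_natCast_mul, ← fourier_neg, ← fourier_add]
        congr 2; ring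
      simp only [this]
      rw [integral_fourier]
      have : ((k : ℤ) - l) * m = 0 ↔ l = k := by
        rw [mul_eq_zero, or_iff_left hm]; omega
      simp only [this]
    simp only [h2, mul_ite, mul_one, mul_zero] at h1
    have h4 : HasSum (fun l => if l = k then (starRingEnd ℂ) (c l) else 0)
        ((starRingEnd ℂ) (c k)) := by
      simpa using hasSum_ite_eq k ((starRingEnd ℂ) (c k)) |>.congr_fun fun l => by
        split_ifs with h <;> simp [h]
    exact h1.unique h4
  have h3 := hasSum_integral_mul hc
    (h := fun k θ => (fourier m θ : ℂ) ^ k * (starRingEnd ℂ) (G θ))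
    (G := fun θ => G θ * (starRingEnd ℂ) (G θ)) (B := B)
    (fun k => by fun_prop)
    (fun k θ => by rw [norm_mul, RCLike.norm_conj, hn, one_mul]; exact hB θ (Set.mem_univ _))
    (fun θ => by simpa only [mul_assoc] using (hG θ).mul_right ((starRingEnd ℂ) (G θ)))
  simp only [hcoeff, Complex.mul_conj, Complex.normSq_eq_norm_sq] at h3
  rw [integral_complex_ofReal] at h3
  exact Complex.hasSum_ofReal.1 h3

/-- Parseval for exp g, together with |exp g|² = exp(2 Re g). -/
lemma hasSum_norm_sq_expCoeff (a : ℕ → ℂ) {m : ℤ} (hm : m ≠ 0) (N : ℕ) :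
    HasSum (fun k => ‖expCoeff (truncate a N) k‖ ^ 2)
      (∫ θ, Real.exp (trigPoly a m N θ) ∂μ₀) := by
  have h := hasSum_norm_sq_of_hasSum (summable_norm_expCoeff a N) hm
    (G := fun θ => Complex.exp (∑ j ∈ Finset.range N, a (j + 1) * (fourier m θ : ℂ) ^ (j + 1)))
    (by fun_prop) (fun θ => hasSum_expCoeff a N _)
  convert h using 3 with θ
  rw [Complex.norm_exp, ← Real.exp_nat_mul, trigPoly]
  push_cast; rfl

/-- **Lebedev-Milin inequality** on the circle, with its coefficientwise deficit. -/
lemma expCoeff_sub_le (a : ℕ → ℂ) {m : ℤ} (hm : m ≠ 0) (N : ℕ) (k : ℕ) :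
    expCoeff (lebedevMilinWeight (truncate a N)) k - ‖expCoeff (truncate a N) k‖ ^ 2
      ≤ Real.exp (∑ j ∈ Finset.range N, ((j : ℝ) + 1) * ‖a (j + 1)‖ ^ 2)
        - ∫ θ, Real.exp (trigPoly a m N θ) ∂μ₀ :=
  le_hasSum ((hasSum_expCoeff_lebedevMilinWeight a N).sub (hasSum_norm_sq_expCoeff a hm N)) k
    fun _ _ => sub_nonneg.2 (norm_sq_expCoeff_le _ _)

lemma integral_exp_trigPoly_le (a : ℕ → ℂ) {m : ℤ} (hm : m ≠ 0) (N : ℕ) :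
    ∫ θ, Real.exp (trigPoly a m N θ) ∂μ₀
      ≤ Real.exp (∑ j ∈ Finset.range N, ((j : ℝ) + 1) * ‖a (j + 1)‖ ^ 2) :=
  hasSum_le (fun _ => norm_sq_expCoeff_le _ _) (hasSum_norm_sq_expCoeff a hm N)
    (hasSum_expCoeff_lebedevMilinWeight a N)

/-! ### Donsker-Varadhan inequality and the logarithmic Hardy-Littlewood-Sobolev inequality -/

lemma mul_le_klFun_add_exp {x : ℝ} (hx : 0 ≤ x) (u : ℝ) : x * u ≤ klFun x + Real.exp u - 1 := by
  rw [klFun_apply]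
  rcases hx.eq_or_lt with rfl | hx
  · simp [Real.exp_nonneg]
  -- Convex duality of x log x − x and exp: the tangent-line bound for exp at u − log x, multiplied
  -- by x.
  · have h := Real.add_one_le_exp (u - Real.log x)
    rw [Real.exp_sub, Real.exp_log hx, le_div_iff₀ hx] at h
    nlinarith

section DonskerVaradhan

variable {α : Type*} [MeasurableSpace α] {q ν : Measure α} [IsProbabilityMeasure q]
  [IsProbabilityMeasure ν] {u : α → ℝ} {M : ℝ}

lemma integrable_of_abs_le (hu : Measurable u) (hM : ∀ x, |u x| ≤ M) (ρ : Measure α)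
    [IsFiniteMeasure ρ] : Integrable u ρ :=
  Integrable.of_bound hu.aestronglyMeasurable M (ae_of_all _ hM)

lemma integrable_exp_of_abs_le (hu : Measurable u) (hM : ∀ x, |u x| ≤ M) (ρ : Measure α)
    [IsFiniteMeasure ρ] : Integrable (fun x => Real.exp (u x)) ρ :=
  Integrable.of_bound hu.exp.aestronglyMeasurable (Real.exp M) (ae_of_all _ fun x => by
    rw [Real.norm_eq_abs, Real.abs_exp]
    exact Real.exp_le_exp.2 ((le_abs_self _).trans (hM x)))

/-- The Donsker-Varadhan inequality, linear form. -/
lemma integral_le_toReal_klDiv_add (h : klDiv q ν ≠ ⊤) (hu : Measurable u)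
    (hM : ∀ x, |u x| ≤ M) :
    ∫ x, u x ∂q ≤ (klDiv q ν).toReal + ∫ x, Real.exp (u x) ∂ν - 1 := by
  obtain ⟨hac, hint⟩ := klDiv_ne_top_iff.1 h
  have hk : Integrable (fun x => klFun (q.rnDeriv ν x).toReal) ν :=
    integrable_klFun_rnDeriv_iff hac |>.2 hint
  have he := integrable_exp_of_abs_le hu hM ν
  rw [toReal_klDiv_eq_integral_klFun hac, ← integral_rnDeriv_smul hac]
  have : ∫ x, klFun (q.rnDeriv ν x).toReal ∂ν + ∫ x, Real.exp (u x) ∂ν - 1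
      = ∫ x, (klFun (q.rnDeriv ν x).toReal + Real.exp (u x) - 1) ∂ν := by
    have h1 := integral_sub (hk.add he) (integrable_const (1 : ℝ))
    simp only [Pi.add_apply] at h1
    rw [h1, integral_add hk he]
    simp
  rw [this]
  refine integral_mono ((integrable_rnDeriv_smul_iff hac).2 (integrable_of_abs_le hu hM q))
    ((hk.add he).sub (integrable_const _)) fun x => ?_
  exact mul_le_klFun_add_exp ENNReal.toReal_nonneg _

/-- The Donsker-Varadhan inequality. -/
lemma integral_le_toReal_klDiv_add_log (h : klDiv q ν ≠ ⊤) (hu : Measurable u)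
    (hM : ∀ x, |u x| ≤ M) :
    ∫ x, u x ∂q ≤ (klDiv q ν).toReal + Real.log (∫ x, Real.exp (u x) ∂ν) := by
  set Z := ∫ x, Real.exp (u x) ∂ν
  have hZ : 0 < Z := integral_exp_pos (integrable_exp_of_abs_le hu hM ν)
  -- Subtracting log Z normalizes the exponential integral to 1, which turns the linear form into
  -- the logarithmic one.
  have h1 := integral_le_toReal_klDiv_add (u := fun x => u x - Real.log Z)
    (M := M + |Real.log Z|) h (hu.sub_const _)
    (fun x => (abs_sub _ _).trans (add_le_add_left (hM x) _))
  rw [integral_sub (integrable_of_abs_le hu hM q) (integrable_const _)] at h1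
  simp only [Real.exp_sub, Real.exp_log hZ, integral_div, integral_const, probReal_univ,
    one_smul] at h1
  rw [div_self hZ.ne'] at h1
  linarith

end DonskerVaradhan

/-- The Fourier coefficient `∫ e(-kθ) dq(θ)` of a measure. -/
def measureCoeff (q : Measure UnitAddCircle) (k : ℤ) : ℂ := ∫ θ, fourier (-k) θ ∂q

/-- The coefficients of the trial function `∑ j, q̂(jm) / j * e(jmθ)`. -/
def trialCoeff (q : Measure UnitAddCircle) (m : ℤ) (j : ℕ) : ℂ := measureCoeff q (j * m) / j

lemma integrable_fourier (q : Measure UnitAddCircle) [IsFiniteMeasure q] (k : ℤ) :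
    Integrable (fun θ => (fourier k θ : ℂ)) q :=
  Integrable.of_bound (fourier k).continuous.aestronglyMeasurable 1
    (ae_of_all _ fun θ => by rw [fourier_apply, Circle.norm_coe])

lemma measureCoeff_neg (q : Measure UnitAddCircle) (k : ℤ) :
    measureCoeff q (-k) = (starRingEnd ℂ) (measureCoeff q k) := by
  unfold measureCoeff
  rw [← integral_conj]
  simp only [fourier_neg]

/-- With a_j = q̂(jm)/j the linear term of Donsker-Varadhan is 2S, where S = ∑ |q̂(jm)|²/j, while
the Lebedev-Milin exponent is S. The difference S is what the entropy then bounds. -/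
lemma integral_trigPoly (q : Measure UnitAddCircle) [IsProbabilityMeasure q] (m : ℤ) (N : ℕ) :
    ∫ θ, trigPoly (trialCoeff q m) m N θ ∂q
      = 2 * ∑ j ∈ Finset.range N, ‖measureCoeff q ((j + 1 : ℕ) * m)‖ ^ 2 / ((j : ℝ) + 1) := by
  have hint : ∀ j ∈ Finset.range N, Integrable
      (fun θ => trialCoeff q m (j + 1) * (fourier m θ : ℂ) ^ (j + 1)) q := by
    intro j _
    simp only [← fourier_natCast_mul]
    exact (integrable_fourier q _).const_mul _
  unfold trigPoly
  rw [integral_const_mul]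
  congr 1
  have h1 := integral_re (integrable_finsetSum _ hint)
  simp only [RCLike.re_to_complex] at h1
  rw [h1, integral_finsetSum _ hint, Complex.re_sum]
  refine Finset.sum_congr rfl fun j _ => ?_
  simp only [← fourier_natCast_mul]
  rw [integral_const_mul]
  have h2 : ∫ θ, (fourier (((j + 1 : ℕ) : ℤ) * m) θ : ℂ) ∂q
      = (starRingEnd ℂ) (measureCoeff q ((j + 1 : ℕ) * m)) := by
    rw [← measureCoeff_neg, measureCoeff, neg_neg]
  rw [h2, trialCoeff, div_mul_eq_mul_div, Complex.mul_conj, Complex.normSq_eq_norm_sq]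
  have : (((j + 1 : ℕ) : ℕ) : ℂ) = (((j : ℝ) + 1 : ℝ) : ℂ) := by push_cast; rfl
  rw [this, ← Complex.ofReal_div, Complex.ofReal_re]

/-- The partial sums `∑ 1 ≤ j ≤ N, |q̂(jm)|² / j`. -/
def logEnergy (q : Measure UnitAddCircle) (m : ℤ) (N : ℕ) : ℝ :=
  ∑ j ∈ Finset.range N, ‖measureCoeff q ((j + 1 : ℕ) * m)‖ ^ 2 / ((j : ℝ) + 1)

lemma logEnergy_eq (q : Measure UnitAddCircle) (m : ℤ) (N : ℕ) :
    ∑ j ∈ Finset.range N, ((j : ℝ) + 1) * ‖trialCoeff q m (j + 1)‖ ^ 2 = logEnergy q m N := by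
  refine Finset.sum_congr rfl fun j _ => ?_
  have hj : (j : ℝ) + 1 ≠ 0 := by positivity
  rw [trialCoeff, norm_div, Complex.norm_natCast, div_pow]
  push_cast
  field_simp

lemma exp_le_integral_exp_trigPoly {q : Measure UnitAddCircle} [IsProbabilityMeasure q]
    (hq : klDiv q μ₀ ≠ ⊤) {m : ℤ} (N : ℕ) :
    Real.exp (2 * logEnergy q m N - (klDiv q μ₀).toReal)
      ≤ ∫ θ, Real.exp (trigPoly (trialCoeff q m) m N θ) ∂μ₀ := by
  obtain ⟨M, hM⟩ := exists_bound_trigPoly (trialCoeff q m) m N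
  have hmeas := (continuous_trigPoly (trialCoeff q m) m N).measurable
  have h := integral_le_toReal_klDiv_add_log hq hmeas hM
  rw [integral_trigPoly] at h
  rw [← Real.le_log_iff_exp_le (integral_exp_pos (integrable_exp_of_abs_le hmeas hM _)),
    logEnergy]
  linarith

/-- The logarithmic Hardy-Littlewood-Sobolev inequality on the circle. -/
lemma logEnergy_le {q : Measure UnitAddCircle} [IsProbabilityMeasure q]
    (hq : klDiv q μ₀ ≠ ⊤) {m : ℤ} (hm : m ≠ 0) (N : ℕ) : logEnergy q m N ≤ (klDiv q μ₀).toReal := by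
  have h := (exp_le_integral_exp_trigPoly hq N).trans
    (integral_exp_trigPoly_le (trialCoeff q m) hm N)
  rw [logEnergy_eq, Real.exp_le_exp] at h
  linarith

/-- The deficit in the logarithmic Hardy-Littlewood-Sobolev inequality controls that of the
Lebedev-Milin inequality. -/
lemma expCoeff_trialCoeff_sub_le {q : Measure UnitAddCircle} [IsProbabilityMeasure q]
    (hq : klDiv q μ₀ ≠ ⊤) {m : ℤ}
    (hm : m ≠ 0) {k N : ℕ} (hk : k ≤ N) :
    expCoeff (lebedevMilinWeight (trialCoeff q m)) k - ‖expCoeff (trialCoeff q m) k‖ ^ 2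
      ≤ Real.exp (klDiv q μ₀).toReal * ((klDiv q μ₀).toReal - logEnergy q m N) := by
  have h := expCoeff_sub_le (trialCoeff q m) hm N k
  have ht : ∀ j ≤ N, truncate (trialCoeff q m) N j = trialCoeff q m j := by
    intro j hj; simp [truncate, hj]
  rw [expCoeff_congr ht k hk, expCoeff_congr (b := lebedevMilinWeight (trialCoeff q m))
    (fun j hj => by rw [lebedevMilinWeight, ht j hj, lebedevMilinWeight]) k hk, logEnergy_eq] at h
  have h2 := exp_le_integral_exp_trigPoly hq (m := m) N
  have h3 := logEnergy_le hq hm N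
  set H := (klDiv q μ₀).toReal
  set S := logEnergy q m N
  -- The left side is e^S (1 − e^(S−H)), and 1 − e^(−y) ≤ y.
  have h4 : Real.exp S - Real.exp (2 * S - H) ≤ Real.exp S * (H - S) := by
    have : Real.exp (2 * S - H) = Real.exp S * Real.exp (S - H) := by
      rw [← Real.exp_add]; ring_nf
    rw [this]
    nlinarith [Real.add_one_le_exp (S - H), Real.exp_pos S]
  have h5 : Real.exp S * (H - S) ≤ Real.exp H * (H - S) :=
    mul_le_mul_of_nonneg_right (Real.exp_le_exp.2 h3) (by linarith)
  linarith

/-! ### Parseval identity for the interaction energy -/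

lemma integrable_comp_sub_prod {G : UnitAddCircle → ℝ} (hm : Measurable G) (hG : Integrable G μ₀)
    (q : Measure UnitAddCircle) [IsFiniteMeasure q] :
    Integrable (fun p : UnitAddCircle × UnitAddCircle => G (p.1 - p.2)) (Measure.prod μ₀ q) := by
  have hmp : Measurable fun p : UnitAddCircle × UnitAddCircle => G (p.1 - p.2) :=
    hm.comp (measurable_fst.sub measurable_snd)
  refine ⟨hmp.aestronglyMeasurable, ?_⟩
  rw [hasFiniteIntegral_iff_enorm, lintegral_prod_symm _ hmp.enorm.aemeasurable]
  simp only
  have : ∀ y : UnitAddCircle, ∫⁻ x, ‖G (x - y)‖ₑ ∂μ₀ = ∫⁻ x, ‖G x‖ₑ ∂μ₀ :=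
    fun y => lintegral_sub_right_eq_self (fun x => ‖G x‖ₑ) y
  simp only [this, lintegral_const]
  exact ENNReal.mul_lt_top hG.2 (measure_lt_top _ _)

/-- Dominating one factor of q by a multiple of Haar measure reduces this to the mixed product,
where translation invariance suffices. -/
lemma integrable_comp_sub_prod_self {G : UnitAddCircle → ℝ} (hm : Measurable G)
    (hG : Integrable G μ₀) {q : Measure UnitAddCircle} [IsFiniteMeasure q] {c : ℝ≥0}
    (hq : q ≤ c • μ₀) :
    Integrable (fun p : UnitAddCircle × UnitAddCircle => G (p.1 - p.2)) (q.prod q) := by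
  have h1 := (integrable_comp_sub_prod hm hG q).smul_measure_nnreal (c := c)
  refine h1.mono_measure ?_
  refine Measure.le_iff.2 fun s hs => ?_
  rw [Measure.prod_apply_symm hs, Measure.smul_apply, Measure.prod_apply_symm hs,
    ENNReal.smul_def, smul_eq_mul, ← lintegral_const_mul _ (measurable_measure_prodMk_right hs)]
  refine lintegral_mono fun y => ?_
  have := hq ((fun x => (x, y)) ⁻¹' s)
  rwa [Measure.smul_apply, ENNReal.smul_def, smul_eq_mul] at this

lemma fourierCoeff_convMeasure {G : UnitAddCircle → ℝ} (hm : Measurable G)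
    (hG : Integrable G μ₀) (q : Measure UnitAddCircle) [IsFiniteMeasure q] (k : ℤ) :
    fourierCoeff (fun x => ((∫ y, G (x - y) ∂q : ℝ) : ℂ)) k
      = fourierCoeff (fun θ => (G θ : ℂ)) k * measureCoeff q k := by
  have hI : Integrable (fun p : UnitAddCircle × UnitAddCircle =>
      (fourier (-k) p.1 : ℂ) * (G (p.1 - p.2) : ℂ)) (Measure.prod μ₀ q) := by
    refine (integrable_comp_sub_prod hm hG q).ofReal.bdd_mul (c := 1) ?_ ?_
    · exact ((fourier (-k)).continuous.comp continuous_fst).aestronglyMeasurable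
    · exact ae_of_all _ fun p => by rw [fourier_apply, Circle.norm_coe]
  have h1 : ∀ y : UnitAddCircle, ∫ x, (fourier (-k) x : ℂ) * (G (x - y) : ℂ) ∂μ₀
      = fourier (-k) y * fourierCoeff (fun θ => (G θ : ℂ)) k := by
    intro y
    rw [fourierCoeff, ← integral_const_mul,
      ← integral_sub_right_eq_self (fun x => (fourier (-k) y : ℂ) * (fourier (-k) x • (G x : ℂ))) y]
    refine integral_congr_ae (ae_of_all _ fun x => ?_)
    simp only [smul_eq_mul, ← mul_assoc]
    rw [fourier_apply, fourier_apply, fourier_apply, ← Circle.coe_mul, ← AddCircle.toCircle_add,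
      ← smul_add, add_sub_cancel]
  calc fourierCoeff (fun x => ((∫ y, G (x - y) ∂q : ℝ) : ℂ)) k
      = ∫ x, ∫ y, (fourier (-k) x : ℂ) * (G (x - y) : ℂ) ∂q ∂μ₀ := by
        rw [fourierCoeff]
        simp only [integral_const_mul, integral_complex_ofReal, smul_eq_mul]
    _ = ∫ y, ∫ x, (fourier (-k) x : ℂ) * (G (x - y) : ℂ) ∂μ₀ ∂q := integral_integral_swap hI
    _ = _ := by
        simp only [h1]
        rw [integral_mul_const, measureCoeff, mul_comm]

/-- Parseval's identity for the self-energy of a measure with bounded density. -/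
lemma hasSum_energy {G : UnitAddCircle → ℝ} (hm : Measurable G) (hG : Integrable G μ₀)
    {q : Measure UnitAddCircle} [IsProbabilityMeasure q] {c : ℝ≥0} (hq : q ≤ c • μ₀) :
    HasSum (fun k : ℤ => fourierCoeff (fun θ => (G θ : ℂ)) k * ((‖measureCoeff q k‖ ^ 2 : ℝ) : ℂ))
      ((∫ p : UnitAddCircle × UnitAddCircle, G (p.1 - p.2) ∂q.prod q : ℝ) : ℂ) := by
  have hac : q ≪ μ₀ := Measure.absolutelyContinuous_of_le_smul hq
  set f : UnitAddCircle → ℝ := fun θ => (q.rnDeriv μ₀ θ).toReal with hf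
  set h : UnitAddCircle → ℝ := fun x => ∫ y, G (x - y) ∂q with hh
  have hfm : Measurable f := (Measure.measurable_rnDeriv _ _).ennreal_toReal
  have hhm : StronglyMeasurable h :=
    StronglyMeasurable.integral_prod_right' (f := fun p : UnitAddCircle × UnitAddCircle =>
      G (p.1 - p.2)) (hm.comp (measurable_fst.sub measurable_snd)).stronglyMeasurable
  have hfb : ∀ᵐ θ ∂μ₀, ‖(f θ : ℂ)‖ ≤ c := by
    have : q.rnDeriv μ₀ ≤ᵐ[μ₀] fun _ => (c : ℝ≥0∞) := by
      refine ae_le_of_forall_setLIntegral_le_of_sigmaFinite (Measure.measurable_rnDeriv _ _)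
        fun s hs _ => ?_
      rw [setLIntegral_const]
      exact (Measure.setLIntegral_rnDeriv_le s).trans (by
        have := hq s
        rwa [Measure.smul_apply, ENNReal.smul_def, smul_eq_mul] at this)
    filter_upwards [this] with θ hθ
    rw [Complex.norm_real, Real.norm_of_nonneg ENNReal.toReal_nonneg]
    exact ENNReal.toReal_le_coe_of_le_coe hθ
  have hhb : ∀ x, ‖(h x : ℂ)‖ ≤ c * ∫ y, |G y| ∂μ₀ := by
    intro x
    rw [Complex.norm_real]
    have hint : Integrable (fun y => |G (x - y)|) μ₀ := (hG.comp_sub_left x).abs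
    calc ‖h x‖ ≤ ∫ y, |G (x - y)| ∂q := norm_integral_le_integral_norm _
      _ ≤ ∫ y, |G (x - y)| ∂(c • μ₀) := integral_mono_measure hq
          (ae_of_all _ fun y => abs_nonneg _) (hint.smul_measure_nnreal)
      _ = c * ∫ y, |G y| ∂μ₀ := by
          rw [integral_smul_nnreal_measure, integral_sub_left_eq_self (fun y => |G y|) μ₀ x]
          rfl
  -- A bounded density makes both f and the convolution G * q bounded, hence square integrable, so
  -- Parseval applies to their inner product even for merely integrable G.
  have hf2 : MemLp (fun θ => (f θ : ℂ)) 2 μ₀ :=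
    MemLp.of_bound (Complex.measurable_ofReal.comp hfm).aestronglyMeasurable _ hfb
  have hh2 : MemLp (fun θ => (h θ : ℂ)) 2 μ₀ :=
    MemLp.of_bound (Complex.continuous_ofReal.comp_stronglyMeasurable hhm).aestronglyMeasurable _
      (ae_of_all _ hhb)
  have key := fourierBasis.hasSum_inner_mul_inner (hf2.toLp _) (hh2.toLp _)
  have hcf : ∀ k, fourierCoeff (hf2.toLp _) k = measureCoeff q k := by
    intro k
    rw [fourierCoeff_congr_ae hf2.coeFn_toLp, fourierCoeff, measureCoeff,
      ← integral_rnDeriv_smul hac]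
    refine integral_congr_ae (ae_of_all _ fun θ => ?_)
    simp [hf, mul_comm]
  have hch : ∀ k, fourierCoeff (hh2.toLp _) k
      = fourierCoeff (fun θ => (G θ : ℂ)) k * measureCoeff q k := by
    intro k
    rw [fourierCoeff_congr_ae hh2.coeFn_toLp, fourierCoeff_convMeasure hm hG]
  have hin : ∀ (v : Lp ℂ 2 μ₀) k, inner ℂ (fourierBasis k) v = fourierCoeff v k := by
    intro v k
    rw [← HilbertBasis.repr_apply_apply, fourierBasis_repr]
  have hin' : ∀ (v : Lp ℂ 2 μ₀) k,
      inner ℂ v (fourierBasis k) = (starRingEnd ℂ) (fourierCoeff v k) := by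
    intro v k
    rw [← hin, inner_conj_symm]
  simp only [hin, hin', hcf, hch] at key
  have hval : inner ℂ (hf2.toLp _) (hh2.toLp _)
      = ((∫ p : UnitAddCircle × UnitAddCircle, G (p.1 - p.2) ∂q.prod q : ℝ) : ℂ) := by
    rw [L2.inner_def, integral_prod _ (integrable_comp_sub_prod_self hm hG hq),
      ← integral_rnDeriv_smul hac, ← integral_complex_ofReal]
    refine integral_congr_ae ?_
    filter_upwards [hf2.coeFn_toLp, hh2.coeFn_toLp] with θ h1 h2
    rw [h1, h2]
    simp [hf, hh, mul_comm]
  rw [hval] at key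
  refine key.congr_fun fun k => ?_
  rw [mul_left_comm, ← Complex.normSq_eq_norm_sq, Complex.normSq_eq_conj_mul_self]

/-! ### Approximation by bounded densities -/

lemma ereal_coe_sub_coe {a b : ℝ≥0∞} (ha : a ≠ ⊤) (hb : b ≠ ⊤) :
    (a : EReal) - (b : EReal) = ((a.toReal - b.toReal : ℝ) : EReal) := by
  lift a to ℝ≥0 using ha
  lift b to ℝ≥0 using hb
  rfl

lemma interactionEnergy_eq_integral {W : UnitAddCircle → ℝ} {q : ProbabilityMeasure UnitAddCircle}
    (h : Integrable (fun p : UnitAddCircle × UnitAddCircle => W (p.1 - p.2))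
      ((q : Measure UnitAddCircle).prod (q : Measure UnitAddCircle))) :
    interactionEnergy W q = ((∫ p : UnitAddCircle × UnitAddCircle, W (p.1 - p.2)
      ∂(q : Measure UnitAddCircle).prod (q : Measure UnitAddCircle) : ℝ) : EReal) := by
  rw [interactionEnergy, integral_eq_lintegral_pos_part_sub_lintegral_neg_part h,
    ereal_coe_sub_coe]
  · exact h.lintegral_lt_top.ne
  · exact h.neg.lintegral_lt_top.ne

section Conditioning

variable {α : Type*} [MeasurableSpace α] {q ν : Measure α}

/-- The sublevel sets of the density of `q` with respect to `ν`. -/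
def densitySublevel (q ν : Measure α) (N : ℕ) : Set α := {x | q.rnDeriv ν x ≤ N}

lemma measurableSet_densitySublevel (N : ℕ) : MeasurableSet (densitySublevel q ν N) :=
  measurableSet_le (Measure.measurable_rnDeriv _ _) measurable_const

lemma monotone_densitySublevel : Monotone (densitySublevel q ν) :=
  fun _ _ h x (hx : q.rnDeriv ν x ≤ _) => le_trans hx (by exact_mod_cast h)

lemma ae_mem_iUnion_densitySublevel [IsProbabilityMeasure q] (hac : q ≪ ν) (k : ℕ) :
    ∀ᵐ x ∂q, x ∈ ⋃ i, densitySublevel q ν (i + k) := by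
  filter_upwards [hac.ae_le (Measure.rnDeriv_lt_top q ν)] with x hx
  obtain ⟨n, hn⟩ := ENNReal.exists_nat_gt hx.ne
  refine Set.mem_iUnion.2 ⟨n, ?_⟩
  exact hn.le.trans (by exact_mod_cast Nat.le_add_right n k)

lemma cond_le_smul [IsProbabilityMeasure q] [IsProbabilityMeasure ν] (hac : q ≪ ν)
    {N : ℕ} (h0 : q (densitySublevel q ν N) ≠ 0) :
    ProbabilityTheory.cond q (densitySublevel q ν N)
      ≤ ((q (densitySublevel q ν N))⁻¹ * N).toNNReal • ν := by
  set A := densitySublevel q ν N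
  have hA : MeasurableSet A := measurableSet_densitySublevel N
  refine Measure.le_iff.2 fun s hs => ?_
  rw [ProbabilityTheory.cond_apply hA, Measure.smul_apply, ENNReal.smul_def,
    ENNReal.coe_toNNReal (ENNReal.mul_ne_top (ENNReal.inv_ne_top.2 h0) (ENNReal.natCast_ne_top N)),
    smul_eq_mul, mul_assoc]
  gcongr
  rw [← Measure.setLIntegral_rnDeriv hac]
  calc ∫⁻ x in A ∩ s, q.rnDeriv ν x ∂ν ≤ ∫⁻ _ in A ∩ s, (N : ℝ≥0∞) ∂ν :=
        setLIntegral_mono measurable_const fun x hx => hx.1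
    _ ≤ N * ν s := by
        rw [setLIntegral_const]; gcongr; exact Set.inter_subset_right

/-- On A the log-likelihood ratio of the conditioned measure is that of q plus the constant −log
q(A). -/
lemma toReal_klDiv_cond [IsProbabilityMeasure q] [IsProbabilityMeasure ν]
    (h : klDiv q ν ≠ ⊤) {A : Set α} (hA : MeasurableSet A) (h0 : q A ≠ 0) :
    klDiv (ProbabilityTheory.cond q A) ν ≠ ⊤ ∧
      (klDiv (ProbabilityTheory.cond q A) ν).toReal
        = (q A)⁻¹.toReal * ∫ x in A, llr q ν x ∂q + Real.log (q A)⁻¹.toReal := by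
  obtain ⟨hac, hint⟩ := klDiv_ne_top_iff.1 h
  have : IsProbabilityMeasure (ProbabilityTheory.cond q A) :=
    ProbabilityTheory.cond_isProbabilityMeasure h0
  have hac' : q.restrict A ≪ ν := Measure.absolutelyContinuous_of_le Measure.restrict_le_self
    |>.trans hac
  have hacA : ProbabilityTheory.cond q A ≪ ν := (Measure.smul_absolutelyContinuous).trans hac'
  have hz : (q A)⁻¹ ≠ ⊤ := ENNReal.inv_ne_top.2 h0
  have hz0 : (q A)⁻¹ ≠ 0 := ENNReal.inv_ne_zero.2 (measure_ne_top q A)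
  have hllr : llr (ProbabilityTheory.cond q A) ν
      =ᵐ[q.restrict A] fun x => llr q ν x + Real.log (q A)⁻¹.toReal := by
    have h1 := llr_smul_left hac' (q A)⁻¹ hz0 hz
    filter_upwards [h1, hac'.ae_le (Measure.rnDeriv_restrict q ν hA),
      ae_restrict_mem hA] with x hx1 hx2 hxA
    rw [ProbabilityTheory.cond, hx1, llr, llr, hx2, Set.indicator_of_mem hxA]
  have hi : Integrable (fun x => llr q ν x + Real.log (q A)⁻¹.toReal) (q.restrict A) :=
    hint.integrableOn.add (integrable_const _)
  have hi' : Integrable (llr (ProbabilityTheory.cond q A) ν) (ProbabilityTheory.cond q A) :=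
    (hi.congr hllr.symm).smul_measure hz
  refine ⟨klDiv_ne_top hacA hi', ?_⟩
  rw [toReal_klDiv_of_measure_eq hacA (by simp)]
  conv_lhs => rw [ProbabilityTheory.cond]
  rw [integral_smul_measure]
  change (q A)⁻¹.toReal • ∫ x in A, llr (ProbabilityTheory.cond q A) ν x ∂q = _
  rw [integral_congr_ae hllr, integral_add hint.integrableOn (integrable_const _)]
  have hqA : (q A).toReal ≠ 0 := (ENNReal.toReal_pos h0 (measure_ne_top q A)).ne'
  simp only [integral_const, smul_eq_mul, Measure.real, Measure.restrict_apply MeasurableSet.univ,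
    Set.univ_inter, ENNReal.toReal_inv]
  field_simp

end Conditioning

lemma tendsto_cond_integral {α E : Type*} [MeasurableSpace α] [NormedAddCommGroup E]
    [NormedSpace ℝ E] {q : Measure α} {A : ℕ → Set α}
    (hA : ∀ i, MeasurableSet (A i)) (hmono : Monotone A) (hU : ∀ᵐ x ∂q, x ∈ ⋃ i, A i)
    (hz : Tendsto (fun i => (q (A i))⁻¹.toReal) atTop (𝓝 1)) {g : α → E} (hg : Integrable g q) :
    Tendsto (fun i => (q (A i))⁻¹.toReal • ∫ x in A i, g x ∂q) atTop (𝓝 (∫ x, g x ∂q)) := by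
  have h := tendsto_setIntegral_of_monotone hA hmono (hg.integrableOn (s := ⋃ i, A i))
  rw [Measure.restrict_eq_self_of_ae_mem hU] at h
  simpa using hz.smul h

/-- Every measure of finite entropy is a limit of measures with bounded densities, together with
its entropy, its Fourier coefficients and its two-point integrals. -/
lemma exists_bounded_density_approx (q : ProbabilityMeasure UnitAddCircle)
    (hq : relEntropy q ≠ ⊤) :
    ∃ p : ℕ → ProbabilityMeasure UnitAddCircle,
      (∀ i, ∃ c : ℝ≥0, (p i : Measure UnitAddCircle) ≤ c • μ₀) ∧
      (∀ i, relEntropy (p i) ≠ ⊤) ∧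
      Tendsto (fun i => (relEntropy (p i)).toReal) atTop (𝓝 (relEntropy q).toReal) ∧
      (∀ k, Tendsto (fun i => measureCoeff (p i) k) atTop (𝓝 (measureCoeff q k))) ∧
      (∀ g : UnitAddCircle × UnitAddCircle → ℝ≥0∞,
        Tendsto (fun i => ∫⁻ x, g x ∂((p i : Measure UnitAddCircle).prod (p i))) atTop
          (𝓝 (∫⁻ x, g x ∂((q : Measure UnitAddCircle).prod q)))) := by
  set Q : Measure UnitAddCircle := (q : Measure UnitAddCircle) with hQ
  have hac : Q ≪ μ₀ := (klDiv_ne_top_iff.1 hq).1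
  have hint : Integrable (llr Q μ₀) Q := (klDiv_ne_top_iff.1 hq).2
  have ht : ∀ k, Tendsto (fun i => Q (densitySublevel Q μ₀ (i + k))) atTop (𝓝 1) := by
    intro k
    have h := tendsto_measure_iUnion_atTop (μ := Q)
      (s := fun i => densitySublevel Q μ₀ (i + k))
      (fun i j hij => monotone_densitySublevel (Nat.add_le_add_right hij k))
    rwa [measure_eq_measure_of_null_sdiff (Set.subset_univ _) (by
      rw [← Set.compl_eq_univ_sdiff]; exact ae_mem_iUnion_densitySublevel hac k), measure_univ] at h
  -- Starting the sequence at a sublevel set of positive mass makes every conditioned measure a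
  -- probability measure.
  obtain ⟨k, hk⟩ := ((ht 0).eventually_ne one_ne_zero).exists
  rw [add_zero] at hk
  set A : ℕ → Set UnitAddCircle := fun i => densitySublevel Q μ₀ (i + k) with hAdef
  have hA : ∀ i, MeasurableSet (A i) := fun i => measurableSet_densitySublevel _
  have hmono : Monotone A := fun i j hij => monotone_densitySublevel (Nat.add_le_add_right hij k)
  have hU : ∀ᵐ x ∂Q, x ∈ ⋃ i, A i := ae_mem_iUnion_densitySublevel hac k
  have h0 : ∀ i, Q (A i) ≠ 0 := fun i h => hk <| measure_mono_null
    (monotone_densitySublevel (Nat.le_add_left k i)) h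
  have hz' : Tendsto (fun i => (Q (A i))⁻¹) atTop (𝓝 1) := by
    simpa using (ht k).inv
  have hz : Tendsto (fun i => (Q (A i))⁻¹.toReal) atTop (𝓝 1) := by
    exact (ENNReal.continuousAt_toReal ENNReal.one_ne_top).tendsto.comp hz'
  have hp : ∀ i, IsProbabilityMeasure (ProbabilityTheory.cond Q (A i)) :=
    fun i => ProbabilityTheory.cond_isProbabilityMeasure (h0 i)
  refine ⟨fun i => ⟨ProbabilityTheory.cond Q (A i), hp i⟩, fun i => ⟨_, cond_le_smul hac (h0 i)⟩,
    fun i => (toReal_klDiv_cond hq (hA i) (h0 i)).1, ?_, fun j => ?_, fun g => ?_⟩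
  · have h1 : ∀ i, (relEntropy ⟨ProbabilityTheory.cond Q (A i), hp i⟩).toReal
        = (Q (A i))⁻¹.toReal * ∫ x in A i, llr Q μ₀ x ∂Q + Real.log (Q (A i))⁻¹.toReal :=
      fun i => (toReal_klDiv_cond hq (hA i) (h0 i)).2
    simp only [h1]
    have h2 : (relEntropy q).toReal = ∫ x, llr Q μ₀ x ∂Q + Real.log 1 := by
      rw [Real.log_one, add_zero]
      exact toReal_klDiv_of_measure_eq hac (by simp)
    rw [h2]
    exact (tendsto_cond_integral hA hmono hU hz hint).add
      ((Real.continuousAt_log one_ne_zero).tendsto.comp hz)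
  · have := tendsto_cond_integral hA hmono hU hz (integrable_fourier Q (-j))
    refine this.congr fun i => ?_
    rw [measureCoeff, ← integral_smul_measure]
    rfl
  · have hAA : ∀ᵐ x ∂Q.prod Q, x ∈ ⋃ i, A i ×ˢ A i := by
      have h1 : ∀ᵐ x ∂Q.prod Q, x.1 ∈ ⋃ i, A i := Measure.quasiMeasurePreserving_fst.ae hU
      have h2 : ∀ᵐ x ∂Q.prod Q, x.2 ∈ ⋃ i, A i := Measure.quasiMeasurePreserving_snd.ae hU
      filter_upwards [h1, h2] with x hx1 hx2
      obtain ⟨i, hi⟩ := Set.mem_iUnion.1 hx1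
      obtain ⟨j, hj⟩ := Set.mem_iUnion.1 hx2
      exact Set.mem_iUnion.2 ⟨max i j, hmono (le_max_left _ _) hi, hmono (le_max_right _ _) hj⟩
    have hmono2 : Monotone fun i => A i ×ˢ A i :=
      fun i j hij => Set.prod_mono (hmono hij) (hmono hij)
    have h1 : Tendsto (fun i => ∫⁻ x in A i ×ˢ A i, g x ∂Q.prod Q) atTop
        (𝓝 (∫⁻ x, g x ∂Q.prod Q)) := by
      have h2 := setLIntegral_iUnion_of_directed (μ := Q.prod Q) g hmono2.directed_le
      rw [Measure.restrict_eq_self_of_ae_mem hAA] at h2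
      rw [h2]
      exact tendsto_atTop_iSup fun i j hij => lintegral_mono_set (hmono2 hij)
    -- The product of the conditioned measures is Q(A i)⁻² times Q × Q restricted to A i × A i.
    -- Monotone convergence handles the restriction, even if the limit is infinite.
    have h3 := ENNReal.Tendsto.mul (ENNReal.Tendsto.mul hz' (by simp) hz' (by simp)) (by simp)
      h1 (by simp)
    rw [one_mul, one_mul] at h3
    refine h3.congr fun i => ?_
    change _ = ∫⁻ x, g x ∂(ProbabilityTheory.cond Q (A i)).prod (ProbabilityTheory.cond Q (A i))
    rw [ProbabilityTheory.cond, Measure.prod_smul_left, Measure.prod_smul_right,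
      Measure.prod_restrict, lintegral_smul_measure, lintegral_smul_measure, smul_eq_mul,
      smul_eq_mul, mul_assoc]

/-- Only ⊤ − ⊤ obstructs continuity of the difference, so finiteness of the second limit is enough.
-/
lemma tendsto_ereal_sub {ι : Type*} {l : Filter ι} {f g : ι → ℝ≥0∞} {a b : ℝ≥0∞}
    (hf : Tendsto f l (𝓝 a)) (hg : Tendsto g l (𝓝 b)) (hb : b ≠ ⊤) :
    Tendsto (fun i => (f i : EReal) - (g i : EReal)) l (𝓝 ((a : EReal) - (b : EReal))) := by
  have h1 : Tendsto (fun i => (f i : EReal)) l (𝓝 (a : EReal)) :=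
    (continuous_coe_ennreal_ereal.tendsto a).comp hf
  have h2 : Tendsto (fun i => -(g i : EReal)) l (𝓝 (-(b : EReal))) :=
    (continuous_neg.tendsto _).comp ((continuous_coe_ennreal_ereal.tendsto b).comp hg)
  have hb' : -(b : EReal) ≠ ⊥ := by simpa using hb
  have h3 := (EReal.continuousAt_add (p := ((a : EReal), -(b : EReal))) (Or.inr hb')
    (Or.inl (by simp))).tendsto.comp (h1.prodMk_nhds h2)
  simpa only [sub_eq_add_neg, Function.comp_def] using h3

lemma lintegral_neg_part_ne_top {W : UnitAddCircle → ℝ} {q : ProbabilityMeasure UnitAddCircle}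
    (h : interactionEnergy W q ≠ ⊥) :
    ∫⁻ p, ENNReal.ofReal (-W (p.1 - p.2))
      ∂((q : Measure UnitAddCircle).prod (q : Measure UnitAddCircle)) ≠ ⊤ := by
  intro h'
  rw [interactionEnergy, h'] at h
  simp at h

/-- Measures of finite entropy and energy are approximated in entropy and energy by measures with
bounded densities. -/
lemma exists_bounded_density_approx_energy {W : UnitAddCircle → ℝ}
    (q : ProbabilityMeasure UnitAddCircle) (hq : relEntropy q ≠ ⊤)
    (hE : interactionEnergy W q ≠ ⊥) :
    ∃ p : ℕ → ProbabilityMeasure UnitAddCircle,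
      (∀ i, ∃ c : ℝ≥0, (p i : Measure UnitAddCircle) ≤ c • μ₀) ∧
      (∀ i, relEntropy (p i) ≠ ⊤) ∧
      Tendsto (fun i => (relEntropy (p i)).toReal) atTop (𝓝 (relEntropy q).toReal) ∧
      (∀ k, Tendsto (fun i => measureCoeff (p i) k) atTop (𝓝 (measureCoeff q k))) ∧
      Tendsto (fun i => interactionEnergy W (p i)) atTop (𝓝 (interactionEnergy W q)) := by
  obtain ⟨p, h1, h2, h3, h4, h5⟩ := exists_bounded_density_approx q hq
  exact ⟨p, h1, h2, h3, h4, tendsto_ereal_sub (h5 _) (h5 _) (lintegral_neg_part_ne_top hE)⟩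

/-! ### Energy bounded by entropy, and the case of equality -/

/-- An interaction potential of period `1 / (n + 1)` whose Fourier coefficients satisfy
`2 Ŵ(n + 1) = 1` and `2 Ŵ(k) ≤ (n + 1) / k`. -/
structure IsLogBounded (n : ℕ) (W : UnitAddCircle → ℝ) : Prop where
  interaction : IsInteraction W
  periodic : Function.Periodic W ((1 / ((n : ℝ) + 1) : ℝ) : UnitAddCircle)
  norm : 2 * WHat W ((n : ℤ) + 1) = 1
  decay : ∀ k : ℕ, 1 ≤ k → 2 * WHat W k ≤ ((n : ℝ) + 1) / k

section FourierCoefficients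

variable {W : UnitAddCircle → ℝ}

lemma fourierCoeff_conj (k : ℤ) :
    (starRingEnd ℂ) (fourierCoeff (fun θ => (W θ : ℂ)) k)
      = fourierCoeff (fun θ => (W θ : ℂ)) (-k) := by
  rw [fourierCoeff, fourierCoeff, ← integral_conj]
  simp

lemma fourierCoeff_neg_of_even (h : ∀ θ, W (-θ) = W θ) (k : ℤ) :
    fourierCoeff (fun θ => (W θ : ℂ)) (-k) = fourierCoeff (fun θ => (W θ : ℂ)) k := by
  rw [fourierCoeff, fourierCoeff,
    ← integral_neg_eq_self (fun θ => (fourier (-k) θ : ℂ) • (W θ : ℂ))]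
  refine integral_congr_ae (ae_of_all _ fun θ => ?_)
  simp [h, fourier_apply]

lemma coe_WHat (h : ∀ θ, W (-θ) = W θ) (k : ℤ) :
    fourierCoeff (fun θ => (W θ : ℂ)) k = (WHat W k : ℂ) := by
  have h1 := fourierCoeff_conj (W := W) k
  rw [fourierCoeff_neg_of_even h] at h1
  exact (Complex.conj_eq_iff_re.1 h1).symm

lemma WHat_neg (h : ∀ θ, W (-θ) = W θ) (k : ℤ) : WHat W (-k) = WHat W k := by
  rw [WHat, fourierCoeff_neg_of_even h, WHat]

lemma WHat_zero (h : ∫ θ, W θ ∂μ₀ = 0) : WHat W 0 = 0 := by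
  have : fourierCoeff (fun θ => (W θ : ℂ)) 0 = ((∫ θ, W θ ∂μ₀ : ℝ) : ℂ) := by
    rw [fourierCoeff, ← integral_complex_ofReal]
    simp
  rw [WHat, this, h]
  simp

lemma fourier_inv_eq_one_iff (n : ℕ) (k : ℤ) :
    fourier k ((1 / ((n : ℝ) + 1) : ℝ) : UnitAddCircle) = 1 ↔ ((n : ℤ) + 1) ∣ k := by
  rw [fourier_coe_apply, Complex.exp_eq_one_iff]
  have hn : (n : ℂ) + 1 ≠ 0 := by exact_mod_cast Nat.succ_ne_zero n
  have hpi : (2 * Real.pi * Complex.I : ℂ) ≠ 0 := Complex.two_pi_I_ne_zero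
  constructor
  · rintro ⟨l, hl⟩
    refine ⟨l, ?_⟩
    have h1 : (2 * Real.pi * Complex.I : ℂ) * (k / (n + 1))
        = (2 * Real.pi * Complex.I : ℂ) * l := by
      push_cast at hl
      rw [mul_comm _ (l : ℂ), ← hl]
      ring
    have h2 := mul_left_cancel₀ hpi h1
    rw [div_eq_iff hn] at h2
    have h3 : (k : ℂ) = ((((n : ℤ) + 1) * l : ℤ) : ℂ) := by
      push_cast; rw [h2]; ring
    exact_mod_cast h3
  · rintro ⟨l, rfl⟩
    refine ⟨l, ?_⟩
    push_cast
    field_simp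

/-- Translation by the period t fixes W but multiplies its k-th coefficient by e(−kt), which differs
from 1. -/
lemma fourierCoeff_eq_zero_of_periodic {n : ℕ}
    (h : Function.Periodic W ((1 / ((n : ℝ) + 1) : ℝ) : UnitAddCircle)) {k : ℤ}
    (hk : ¬ ((n : ℤ) + 1) ∣ k) : fourierCoeff (fun θ => (W θ : ℂ)) k = 0 := by
  set t : UnitAddCircle := ((1 / ((n : ℝ) + 1) : ℝ) : UnitAddCircle) with ht
  have h1 : fourierCoeff (fun θ => (W θ : ℂ)) k
      = fourier (-k) t * fourierCoeff (fun θ => (W θ : ℂ)) k := by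
    conv_lhs => rw [fourierCoeff,
      ← integral_add_right_eq_self (fun θ => (fourier (-k) θ : ℂ) • (W θ : ℂ)) t]
    rw [fourierCoeff, ← integral_const_mul]
    refine integral_congr_ae (ae_of_all _ fun θ => ?_)
    have : (fourier (-k) (θ + t) : ℂ) = fourier (-k) t * fourier (-k) θ := by
      rw [fourier_apply, fourier_apply, fourier_apply, smul_add, AddCircle.toCircle_add,
        Circle.coe_mul, mul_comm]
    simp only [smul_eq_mul, h θ, this, mul_assoc]
  have h2 : fourier (-k) t ≠ 1 := by
    rw [ht, Ne, fourier_inv_eq_one_iff, dvd_neg]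
    exact hk
  by_contra h3
  exact h2 (mul_right_cancel₀ h3 (by rw [one_mul]; exact h1.symm))

end FourierCoefficients

namespace IsLogBounded

variable {n : ℕ} {W : UnitAddCircle → ℝ}

lemma WHat_eq_zero (h : IsLogBounded n W) {k : ℤ} (hk : ¬ ((n : ℤ) + 1) ∣ k) : WHat W k = 0 := by
  rw [WHat, fourierCoeff_eq_zero_of_periodic h.periodic hk, Complex.zero_re]

lemma two_mul_WHat_le (h : IsLogBounded n W) (j : ℕ) :
    2 * WHat W ((j + 1 : ℕ) * ((n : ℤ) + 1)) ≤ 1 / ((j : ℝ) + 1) := by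
  have := h.decay ((j + 1) * (n + 1)) (Nat.mul_pos j.succ_pos n.succ_pos)
  push_cast at this ⊢
  refine this.trans (le_of_eq ?_)
  have : (n : ℝ) + 1 ≠ 0 := by positivity
  field_simp

/-- Stated for an abstract coefficient sequence because it is needed both for W and for its
positive-definite part. -/
lemma hasSum_energy_nat (n : ℕ) {V : UnitAddCircle → ℝ} {v : ℤ → ℝ}
    (hVm : Measurable V) (hVi : Integrable V μ₀)
    (hV : ∀ k, fourierCoeff (fun θ => (V θ : ℂ)) k = (v k : ℂ)) (hv0 : v 0 = 0)
    (hve : ∀ k, v (-k) = v k) (hvz : ∀ k, ¬ ((n : ℤ) + 1) ∣ k → v k = 0)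
    {p : Measure UnitAddCircle} [IsProbabilityMeasure p] {c : ℝ≥0} (hp : p ≤ c • μ₀) :
    HasSum (fun j : ℕ => 2 * v ((j + 1 : ℕ) * ((n : ℤ) + 1))
        * ‖measureCoeff p ((j + 1 : ℕ) * ((n : ℤ) + 1))‖ ^ 2)
      (∫ x : UnitAddCircle × UnitAddCircle, V (x.1 - x.2) ∂p.prod p) := by
  have h1 := hasSum_energy hVm hVi hp
  simp only [hV, ← Complex.ofReal_mul] at h1
  have h2 := Complex.hasSum_ofReal.1 h1
  have hinj : Function.Injective fun j : ℤ => j * ((n : ℤ) + 1) :=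
    mul_left_injective₀ (by positivity)
  rw [← hinj.hasSum_iff] at h2
  · have h3 := h2.nat_add_neg
    rw [← hasSum_nat_add_iff' 1] at h3
    simp only [Function.comp_apply, Finset.range_one, Finset.sum_singleton, Nat.cast_zero, neg_zero,
      zero_mul, hv0, add_zero, sub_zero] at h3
    refine h3.congr_fun fun j => ?_
    rw [neg_mul, hve, measureCoeff_neg, RCLike.norm_conj]
    ring
  · intro k hk
    rw [hvz k, zero_mul]
    rintro ⟨l, rfl⟩
    exact hk ⟨l, mul_comm _ _⟩

lemma hasSum_energy_self (h : IsLogBounded n W) {p : Measure UnitAddCircle}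
    [IsProbabilityMeasure p] {c : ℝ≥0} (hp : p ≤ c • μ₀) :
    HasSum (fun j : ℕ => 2 * WHat W ((j + 1 : ℕ) * ((n : ℤ) + 1))
        * ‖measureCoeff p ((j + 1 : ℕ) * ((n : ℤ) + 1))‖ ^ 2)
      (∫ x : UnitAddCircle × UnitAddCircle, W (x.1 - x.2) ∂p.prod p) :=
  hasSum_energy_nat n h.interaction.measurable h.interaction.integrable
    (coe_WHat h.interaction.even) (WHat_zero h.interaction.mean_zero)
    (WHat_neg h.interaction.even) (fun _ => h.WHat_eq_zero) hp

lemma interactionEnergy_eq (h : IsLogBounded n W) {p : ProbabilityMeasure UnitAddCircle}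
    {c : ℝ≥0} (hp : (p : Measure UnitAddCircle) ≤ c • μ₀) :
    interactionEnergy W p = ((∫ x : UnitAddCircle × UnitAddCircle, W (x.1 - x.2)
      ∂(p : Measure UnitAddCircle).prod (p : Measure UnitAddCircle) : ℝ) : EReal) :=
  interactionEnergy_eq_integral (integrable_comp_sub_prod_self h.interaction.measurable
    h.interaction.integrable hp)

lemma succ_ne_zero (n : ℕ) : (n : ℤ) + 1 ≠ 0 := by positivity

/-- For a bounded density, the energy falls short of the entropy by the defect of each Fourier
coefficient. -/
lemma energy_add_le_of_bounded (h : IsLogBounded n W) {p : ProbabilityMeasure UnitAddCircle}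
    (hH : relEntropy p ≠ ⊤) {c : ℝ≥0} (hp : (p : Measure UnitAddCircle) ≤ c • μ₀) (j : ℕ) :
    ∫ x : UnitAddCircle × UnitAddCircle, W (x.1 - x.2)
        ∂(p : Measure UnitAddCircle).prod (p : Measure UnitAddCircle)
      + (1 / ((j : ℝ) + 1) - 2 * WHat W ((j + 1 : ℕ) * ((n : ℤ) + 1)))
        * ‖measureCoeff p ((j + 1 : ℕ) * ((n : ℤ) + 1))‖ ^ 2 ≤ (relEntropy p).toReal := by
  rw [← le_sub_iff_add_le]
  -- For N > j, `logEnergy` minus the N-th partial sum of the energy is a sum of nonnegative defects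
  -- that contains the j-th one.
  refine le_of_tendsto (h.hasSum_energy_self hp).tendsto_sum_nat
    (eventually_gt_atTop j |>.mono fun N hN => ?_)
  rw [le_sub_iff_add_le, add_comm, ← le_sub_iff_add_le]
  have h1 := logEnergy_le hH (succ_ne_zero n) N
  refine le_trans ?_ (sub_le_sub_right h1 _)
  rw [logEnergy, ← Finset.sum_sub_distrib]
  have h2 : ∀ i ∈ Finset.range N, 0 ≤ ‖measureCoeff p ((i + 1 : ℕ) * ((n : ℤ) + 1))‖ ^ 2
      / ((i : ℝ) + 1) - 2 * WHat W ((i + 1 : ℕ) * ((n : ℤ) + 1))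
        * ‖measureCoeff p ((i + 1 : ℕ) * ((n : ℤ) + 1))‖ ^ 2 := by
    intro i _
    have := mul_le_mul_of_nonneg_right (h.two_mul_WHat_le i)
      (sq_nonneg ‖measureCoeff p ((i + 1 : ℕ) * ((n : ℤ) + 1))‖)
    rw [div_eq_mul_one_div, mul_comm _ (1 / ((i : ℝ) + 1))]
    linarith
  refine le_trans (le_of_eq ?_) (Finset.single_le_sum h2 (Finset.mem_range.2 hN))
  ring

lemma expCoeff_sub_le_of_bounded (h : IsLogBounded n W) {p : ProbabilityMeasure UnitAddCircle}
    (hH : relEntropy p ≠ ⊤) {c : ℝ≥0} (hp : (p : Measure UnitAddCircle) ≤ c • μ₀) (k : ℕ) :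
    expCoeff (lebedevMilinWeight (trialCoeff p ((n : ℤ) + 1))) k
        - ‖expCoeff (trialCoeff p ((n : ℤ) + 1)) k‖ ^ 2
      ≤ Real.exp (relEntropy p).toReal * ((relEntropy p).toReal
        - ∫ x : UnitAddCircle × UnitAddCircle, W (x.1 - x.2)
          ∂(p : Measure UnitAddCircle).prod (p : Measure UnitAddCircle)) := by
  have h1 := ((h.hasSum_energy_self hp).tendsto_sum_nat.const_sub
    (relEntropy p).toReal).const_mul (Real.exp (relEntropy p).toReal)
  refine ge_of_tendsto h1 (eventually_ge_atTop k |>.mono fun N hN => ?_)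
  refine (expCoeff_trialCoeff_sub_le hH (succ_ne_zero n) hN).trans ?_
  refine mul_le_mul_of_nonneg_left (sub_le_sub_left ?_ _) (Real.exp_nonneg _)
  refine Finset.sum_le_sum fun i _ => ?_
  rw [div_eq_mul_one_div, mul_comm _ (1 / ((i : ℝ) + 1))]
  exact mul_le_mul_of_nonneg_right (h.two_mul_WHat_le i) (sq_nonneg _)

lemma energy_le_of_bounded (h : IsLogBounded n W) {p : ProbabilityMeasure UnitAddCircle}
    (hH : relEntropy p ≠ ⊤) {c : ℝ≥0} (hp : (p : Measure UnitAddCircle) ≤ c • μ₀) :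
    ∫ x : UnitAddCircle × UnitAddCircle, W (x.1 - x.2)
        ∂(p : Measure UnitAddCircle).prod (p : Measure UnitAddCircle)
      ≤ (relEntropy p).toReal := by
  refine le_trans (le_add_of_nonneg_right ?_) (h.energy_add_le_of_bounded hH hp 0)
  exact mul_nonneg (sub_nonneg.2 (h.two_mul_WHat_le 0)) (sq_nonneg _)

/-- The interaction energy is at most the relative entropy. -/
lemma interactionEnergy_le (h : IsLogBounded n W) {q : ProbabilityMeasure UnitAddCircle}
    (hH : relEntropy q ≠ ⊤) : interactionEnergy W q ≤ ((relEntropy q).toReal : EReal) := by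
  by_cases hE : interactionEnergy W q = ⊥
  · rw [hE]; exact bot_le
  obtain ⟨p, h1, h2, h3, -, h5⟩ := exists_bounded_density_approx_energy q hH hE
  refine le_of_tendsto_of_tendsto' h5 (EReal.tendsto_coe.2 h3) fun i => ?_
  obtain ⟨c, hc⟩ := h1 i
  rw [h.interactionEnergy_eq hc, EReal.coe_le_coe_iff]
  exact h.energy_le_of_bounded (h2 i) hc

/-- A finite-entropy measure of energy other than `-∞` has a real energy, and is approximated by
measures with bounded densities in energy and entropy. -/
lemma exists_approx (h : IsLogBounded n W) {q : ProbabilityMeasure UnitAddCircle}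
    (hH : relEntropy q ≠ ⊤) (hE : interactionEnergy W q ≠ ⊥) :
    ∃ (e : ℝ) (p : ℕ → ProbabilityMeasure UnitAddCircle),
      interactionEnergy W q = e ∧
      (∀ i, ∃ c : ℝ≥0, (p i : Measure UnitAddCircle) ≤ c • μ₀) ∧
      (∀ i, relEntropy (p i) ≠ ⊤) ∧
      Tendsto (fun i => (relEntropy (p i)).toReal) atTop (𝓝 (relEntropy q).toReal) ∧
      (∀ k, Tendsto (fun i => measureCoeff (p i) k) atTop (𝓝 (measureCoeff q k))) ∧
      Tendsto (fun i => ∫ x : UnitAddCircle × UnitAddCircle, W (x.1 - x.2)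
        ∂(p i : Measure UnitAddCircle).prod (p i : Measure UnitAddCircle)) atTop (𝓝 e) := by
  obtain ⟨p, h1, h2, h3, h4, h5⟩ := exists_bounded_density_approx_energy q hH hE
  have htop : interactionEnergy W q ≠ ⊤ :=
    ((h.interactionEnergy_le hH).trans_lt (EReal.coe_lt_top _)).ne
  obtain ⟨e, he⟩ : ∃ e : ℝ, interactionEnergy W q = e :=
    ⟨_, (EReal.coe_toReal htop hE).symm⟩
  refine ⟨e, p, he, h1, h2, h3, h4, ?_⟩
  rw [he] at h5
  refine EReal.tendsto_coe.1 (h5.congr fun i => ?_)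
  obtain ⟨c, hc⟩ := h1 i
  exact h.interactionEnergy_eq hc

/-- The Fourier coefficients of a measure whose energy equals its entropy. -/
lemma equality_case (h : IsLogBounded n W) {q : ProbabilityMeasure UnitAddCircle}
    (hH : relEntropy q ≠ ⊤) (hE : ((relEntropy q).toReal : EReal) ≤ interactionEnergy W q) :
    (∀ j : ℕ, measureCoeff q ((j + 1 : ℕ) * ((n : ℤ) + 1))
      = measureCoeff q ((n : ℤ) + 1) ^ (j + 1)) ∧
    ∀ j : ℕ, (1 / ((j : ℝ) + 1) - 2 * WHat W ((j + 1 : ℕ) * ((n : ℤ) + 1)))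
        * ‖measureCoeff q ((j + 1 : ℕ) * ((n : ℤ) + 1))‖ ^ 2 = 0 := by
  have hbot : interactionEnergy W q ≠ ⊥ := fun h' => by simp [h'] at hE
  obtain ⟨e, p, he, h1, h2, h3, h4, h5⟩ := h.exists_approx hH hbot
  have heq : (relEntropy q).toReal = e := by
    refine le_antisymm ?_ ?_
    · rwa [he, EReal.coe_le_coe_iff] at hE
    · have := h.interactionEnergy_le hH
      rwa [he, EReal.coe_le_coe_iff] at this
  rw [heq] at h3
  have ht : ∀ k, Tendsto (fun i => trialCoeff (p i) ((n : ℤ) + 1) k) atTop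
      (𝓝 (trialCoeff q ((n : ℤ) + 1) k)) := fun k => (h4 _).div_const _
  constructor
  · have hLM : ∀ k, ‖expCoeff (trialCoeff q ((n : ℤ) + 1)) k‖ ^ 2
        = expCoeff (lebedevMilinWeight (trialCoeff q ((n : ℤ) + 1))) k := by
      intro k
      refine le_antisymm (norm_sq_expCoeff_le _ _) (sub_nonpos.1 ?_)
      have hl : Tendsto (fun i => expCoeff (lebedevMilinWeight (trialCoeff (p i) ((n : ℤ) + 1))) k
          - ‖expCoeff (trialCoeff (p i) ((n : ℤ) + 1)) k‖ ^ 2) atTop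
          (𝓝 (expCoeff (lebedevMilinWeight (trialCoeff q ((n : ℤ) + 1))) k
          - ‖expCoeff (trialCoeff q ((n : ℤ) + 1)) k‖ ^ 2)) :=
        (tendsto_expCoeff (fun j => ((ht j).norm.pow 2).const_mul _) k).sub
          ((tendsto_expCoeff ht k).norm.pow 2)
      have hr := (Real.continuous_exp.tendsto e |>.comp h3).mul (h3.sub h5)
      rw [sub_self, mul_zero] at hr
      refine le_of_tendsto_of_tendsto' hl hr fun i => ?_
      obtain ⟨c, hc⟩ := h1 i
      exact h.expCoeff_sub_le_of_bounded (h2 i) hc k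
    intro j
    have h6 := (eq_of_norm_sq_expCoeff_eq hLM (j + 1)).2 (by omega)
    have hj : ((j + 1 : ℕ) : ℂ) ≠ 0 := by exact_mod_cast j.succ_ne_zero
    simp only [trialCoeff] at h6
    rw [mul_div_cancel₀ _ hj] at h6
    simpa using h6
  · intro j
    refine le_antisymm ?_ (mul_nonneg (sub_nonneg.2 (h.two_mul_WHat_le j)) (sq_nonneg _))
    have h6 := h5.add (((h4 ((j + 1 : ℕ) * ((n : ℤ) + 1))).norm.pow 2).const_mul
      (1 / ((j : ℝ) + 1) - 2 * WHat W ((j + 1 : ℕ) * ((n : ℤ) + 1))))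
    have h7 := le_of_tendsto_of_tendsto' h6 h3 fun i => by
      obtain ⟨c, hc⟩ := h1 i
      exact h.energy_add_le_of_bounded (h2 i) hc j
    linarith

/-- The energy is controlled by an arbitrarily small multiple of the entropy. -/
lemma exists_energy_bound (h : IsLogBounded n W) (K : ℝ≥0) :
    ∃ C : ℝ≥0, ∀ (q : ProbabilityMeasure UnitAddCircle) (e : ℝ), relEntropy q ≠ ⊤ →
      interactionEnergy W q = e → K * e ≤ (relEntropy q).toReal + C := by
  obtain ⟨V, ⟨hVm, hVi, hVc⟩, hV⟩ := h.interaction.lower_bound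
  obtain ⟨C, hC⟩ := hV K
  have hbdd : ∀ (p : ProbabilityMeasure UnitAddCircle) (c : ℝ≥0), relEntropy p ≠ ⊤ →
      (p : Measure UnitAddCircle) ≤ c • μ₀ →
      K * ∫ x : UnitAddCircle × UnitAddCircle, W (x.1 - x.2)
        ∂(p : Measure UnitAddCircle).prod (p : Measure UnitAddCircle)
      ≤ (relEntropy p).toReal + C := by
    intro p c hp hc
    have hint := integrable_comp_sub_prod_self hVm hVi hc
    have h1 : ∫ x : UnitAddCircle × UnitAddCircle, W (x.1 - x.2)
        ∂(p : Measure UnitAddCircle).prod (p : Measure UnitAddCircle)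
        ≤ ∫ x : UnitAddCircle × UnitAddCircle, V (x.1 - x.2)
        ∂(p : Measure UnitAddCircle).prod (p : Measure UnitAddCircle) := by
      refine hasSum_le (fun j => ?_) (h.hasSum_energy_self hc)
        (hasSum_energy_nat n (v := fun k => max (WHat W k) 0) hVm hVi hVc ?_ ?_ ?_ hc)
      · have := le_max_left (WHat W ((j + 1 : ℕ) * ((n : ℤ) + 1))) 0
        gcongr
      · simp [WHat_zero h.interaction.mean_zero]
      · simp [WHat_neg h.interaction.even]
      · intro k hk; simp [h.WHat_eq_zero hk]
    have h2 : ∫ x : UnitAddCircle × UnitAddCircle, V (x.1 - x.2)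
        ∂(p : Measure UnitAddCircle).prod (p : Measure UnitAddCircle)
        ≤ (∫⁻ x, ENNReal.ofReal (V (x.1 - x.2))
          ∂((p : Measure UnitAddCircle).prod (p : Measure UnitAddCircle))).toReal := by
      rw [integral_eq_lintegral_pos_part_sub_lintegral_neg_part hint]
      exact sub_le_self _ ENNReal.toReal_nonneg
    have h3 := ENNReal.toReal_mono (ENNReal.add_ne_top.2 ⟨hp, ENNReal.coe_ne_top⟩) (hC p)
    rw [ENNReal.toReal_mul, ENNReal.toReal_add hp ENNReal.coe_ne_top] at h3
    exact (mul_le_mul_of_nonneg_left (h1.trans h2) K.2).trans h3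
  refine ⟨C, fun q e hH he => ?_⟩
  obtain ⟨e', p, he', h1, h2, h3, -, h5⟩ :=
    h.exists_approx hH (by rw [he]; exact EReal.coe_ne_bot e)
  obtain rfl : e = e' := EReal.coe_injective (he.symm.trans he')
  refine le_of_tendsto_of_tendsto' (h5.const_mul (K : ℝ)) (h3.add_const (C : ℝ)) fun i => ?_
  obtain ⟨c, hc⟩ := h1 i
  exact hbdd _ c (h2 i) hc

end IsLogBounded

/-! ### Fourier uniqueness and measures of zero energy -/

/-- Finite measures on the circle are determined by their Fourier coefficients. -/
lemma ext_of_measureCoeff_eq {ρ σ : Measure UnitAddCircle} [IsFiniteMeasure ρ] [IsFiniteMeasure σ]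
    (h : ∀ k, measureCoeff ρ k = measureCoeff σ k) : ρ = σ := by
  have hint : ∀ (τ : Measure UnitAddCircle) [IsFiniteMeasure τ] (f : C(UnitAddCircle, ℂ)),
      Integrable f τ := fun τ _ f => Integrable.of_bound f.continuous.aestronglyMeasurable ‖f‖
        (ae_of_all _ f.norm_coe_le_norm)
  have hcont : ∀ (τ : Measure UnitAddCircle) [IsFiniteMeasure τ],
      Continuous fun f : C(UnitAddCircle, ℂ) => ∫ x, f x ∂τ := by
    intro τ _
    refine (LipschitzWith.of_dist_le_mul (K := (τ Set.univ).toNNReal) fun f g => ?_).continuous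
    rw [dist_eq_norm, dist_eq_norm, ← integral_sub (hint τ f) (hint τ g)]
    refine (norm_integral_le_of_norm_le_const (C := ‖f - g‖)
      (ae_of_all _ fun x => (f - g).norm_coe_le_norm x)).trans (le_of_eq ?_)
    rw [mul_comm]; rfl
  let S : Submodule ℂ C(UnitAddCircle, ℂ) :=
    { carrier := {f | ∫ x, f x ∂ρ = ∫ x, f x ∂σ}
      add_mem' := fun {f g} hf hg => by
        simp only [Set.mem_ofPred_eq, ContinuousMap.add_apply] at *
        rw [integral_add (hint ρ f) (hint ρ g), integral_add (hint σ f) (hint σ g), hf, hg]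
      zero_mem' := by simp
      smul_mem' := fun c f hf => by
        simp only [Set.mem_ofPred_eq, ContinuousMap.smul_apply] at *
        rw [integral_smul, integral_smul, hf] }
  have hS : IsClosed (S : Set C(UnitAddCircle, ℂ)) := isClosed_eq (hcont ρ) (hcont σ)
  have hle : Submodule.span ℂ (Set.range (@fourier 1)) ≤ S := by
    rw [Submodule.span_le]
    rintro _ ⟨k, rfl⟩
    have := h (-k)
    rw [measureCoeff, measureCoeff, neg_neg] at this
    exact this
  have htop : S = ⊤ := by
    rw [eq_top_iff, ← span_fourier_closure_eq_top]
    exact Submodule.topologicalClosure_minimal _ hle hS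
  refine ext_of_forall_integral_eq_of_IsFiniteMeasure fun f => ?_
  have hf : (⟨fun x => (f x : ℂ), by fun_prop⟩ : C(UnitAddCircle, ℂ)) ∈ S := by
    rw [htop]; trivial
  change ∫ x, (f x : ℂ) ∂ρ = ∫ x, (f x : ℂ) ∂σ at hf
  rw [integral_complex_ofReal, integral_complex_ofReal] at hf
  exact_mod_cast hf

lemma measureCoeff_zero (q : Measure UnitAddCircle) [IsProbabilityMeasure q] :
    measureCoeff q 0 = 1 := by
  simp [measureCoeff]

lemma measureCoeff_haarAddCircle (k : ℤ) : measureCoeff μ₀ k = if k = 0 then 1 else 0 := by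
  rw [measureCoeff, integral_fourier]; simp

lemma fourier_add_apply (k : ℤ) (x y : UnitAddCircle) :
    (fourier k (x + y) : ℂ) = fourier k x * fourier k y := by
  rw [fourier_apply, fourier_apply, fourier_apply, smul_add, AddCircle.toCircle_add,
    Circle.coe_mul]

lemma measureCoeff_map_add (ρ : Measure UnitAddCircle) (t : UnitAddCircle) (k : ℤ) :
    measureCoeff (ρ.map (· + t)) k = fourier (-k) t * measureCoeff ρ k := by
  rw [measureCoeff, integral_map (measurable_add_const t).aemeasurable
    (fourier (-k)).continuous.aestronglyMeasurable, measureCoeff, ← integral_const_mul]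
  simp only [fourier_add_apply, mul_comm]

lemma measureCoeff_map_sub (q : Measure UnitAddCircle) [IsProbabilityMeasure q] (k : ℤ) :
    measureCoeff ((q.prod q).map fun p => p.1 - p.2) k
      = measureCoeff q k * (starRingEnd ℂ) (measureCoeff q k) := by
  have hsub : Measurable fun p : UnitAddCircle × UnitAddCircle => p.1 - p.2 :=
    measurable_fst.sub measurable_snd
  rw [measureCoeff, integral_map hsub.aemeasurable
    (fourier (-k)).continuous.aestronglyMeasurable, ← measureCoeff_neg, measureCoeff, measureCoeff,
    ← integral_prod_mul]
  refine integral_congr_ae (ae_of_all _ fun p => ?_)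
  simp only
  rw [sub_eq_add_neg, fourier_add_apply]
  congr 1
  simp [fourier_apply]

/-- If the Fourier coefficients of a measure vanish at the nonzero multiples of `n + 1`, then
it gives nonnegative functions of period `1 / (n + 1)` the same integral as Haar measure. -/
lemma lintegral_eq_of_periodic {n : ℕ} {ρ : Measure UnitAddCircle} [IsProbabilityMeasure ρ]
    (hρ : ∀ l : ℤ, l ≠ 0 → measureCoeff ρ (((n : ℤ) + 1) * l) = 0) {G : UnitAddCircle → ℝ≥0∞}
    (hG : Measurable G)
    (hper : Function.Periodic G ((1 / ((n : ℝ) + 1) : ℝ) : UnitAddCircle)) :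
    ∫⁻ x, G x ∂ρ = ∫⁻ x, G x ∂μ₀ := by
  set t : UnitAddCircle := ((1 / ((n : ℝ) + 1) : ℝ) : UnitAddCircle) with ht
  -- Summing the n + 1 translates kills the frequencies not divisible by n + 1 through a geometric
  -- sum of roots of unity; `hρ` kills the other nonzero ones. So σ is a multiple of Haar measure,
  -- and G does not see the translations.
  set σ : Measure UnitAddCircle := ∑ i ∈ Finset.range (n + 1), ρ.map (· + i • t) with hσ
  have hpt : ∀ (k : ℤ) (i : ℕ), (fourier k (i • t) : ℂ) = fourier k t ^ i := by
    intro k i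
    induction i with
    | zero => simp
    | succ i ih => rw [succ_nsmul, fourier_add_apply, ih, pow_succ]
  have hcoeff : ∀ k, measureCoeff σ k
      = (∑ i ∈ Finset.range (n + 1), fourier (-k) t ^ i) * measureCoeff ρ k := by
    intro k
    have h1 : measureCoeff σ k
        = ∑ i ∈ Finset.range (n + 1), measureCoeff (ρ.map (· + i • t)) k := by
      rw [measureCoeff, hσ, integral_finsetSum_measure fun i _ => integrable_fourier _ _]
      rfl
    rw [h1, Finset.sum_mul]
    refine Finset.sum_congr rfl fun i _ => ?_
    rw [measureCoeff_map_add, hpt]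
  have hσeq : σ = (n + 1 : ℕ) • μ₀ := by
    refine ext_of_measureCoeff_eq fun k => ?_
    have h2 : measureCoeff ((n + 1 : ℕ) • μ₀) k = (n + 1 : ℕ) * measureCoeff μ₀ k := by
      rw [measureCoeff, measureCoeff, ← Nat.cast_smul_eq_nsmul ℝ≥0∞, integral_smul_measure,
        ENNReal.toReal_natCast, Complex.real_smul, Complex.ofReal_natCast]
    rw [hcoeff, h2, measureCoeff_haarAddCircle]
    split_ifs with hk
    · subst hk
      simp [measureCoeff_zero]
    · rw [mul_zero]
      by_cases hd : ((n : ℤ) + 1) ∣ k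
      · obtain ⟨l, rfl⟩ := hd
        rw [hρ l (by rintro rfl; simp at hk), mul_zero]
      · have h1 : (fourier (-k) t : ℂ) ≠ 1 := by
          rw [ht, Ne, fourier_inv_eq_one_iff, dvd_neg]
          exact hd
        have h3 : (fourier (-k) t : ℂ) ^ (n + 1) = 1 := by
          rw [← hpt]
          have : (n + 1) • t = 0 := by
            rw [ht, ← AddCircle.coe_nsmul]
            have : (n + 1) • (1 / ((n : ℝ) + 1)) = 1 := by
              rw [nsmul_eq_mul]; push_cast; field_simp
            rw [this, AddCircle.coe_period]
          rw [this, fourier_eval_zero]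
        rw [geom_sum_eq h1, h3, sub_self, zero_div, zero_mul]
  have hperi : ∀ (i : ℕ) x, G (x + i • t) = G x := fun i x => hper.nsmul i x
  have h1 : ∫⁻ x, G x ∂σ = (n + 1 : ℕ) * ∫⁻ x, G x ∂ρ := by
    rw [hσ, lintegral_finsetSum_measure]
    have : ∀ i ∈ Finset.range (n + 1), ∫⁻ x, G x ∂(ρ.map (· + i • t)) = ∫⁻ x, G x ∂ρ := by
      intro i _
      rw [lintegral_map hG (measurable_add_const _)]
      simp only [hperi]
    rw [Finset.sum_congr rfl this]
    simp
  rw [hσeq, ← Nat.cast_smul_eq_nsmul ℝ≥0∞, lintegral_smul_measure, smul_eq_mul] at h1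
  exact ((ENNReal.mul_right_inj (by simp) (ENNReal.natCast_ne_top _)).1 h1).symm

namespace IsLogBounded

variable {n : ℕ} {W : UnitAddCircle → ℝ}

/-- Here q need not have a bounded density, so Parseval is unavailable. Instead, the law of the
difference of two independent q-samples has coefficients |q̂(k)|², so it integrates the positive and
negative parts of W as Haar measure does, and W has mean zero. -/
lemma interactionEnergy_eq_zero (h : IsLogBounded n W) {q : ProbabilityMeasure UnitAddCircle}
    (hq : ∀ j : ℕ, measureCoeff q ((j + 1 : ℕ) * ((n : ℤ) + 1)) = 0) :
    interactionEnergy W q = 0 := by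
  set Q : Measure UnitAddCircle := (q : Measure UnitAddCircle)
  have hsub : Measurable fun p : UnitAddCircle × UnitAddCircle => p.1 - p.2 :=
    measurable_fst.sub measurable_snd
  have : IsProbabilityMeasure ((Q.prod Q).map fun p => p.1 - p.2) :=
    Measure.isProbabilityMeasure_map hsub.aemeasurable
  have hz : ∀ l : ℤ, l ≠ 0 → measureCoeff Q (((n : ℤ) + 1) * l) = 0 := by
    intro l hl
    rcases lt_or_gt_of_ne hl with hl | hl
    · obtain ⟨j, hj⟩ := Int.eq_succ_of_zero_lt (neg_pos.2 hl)
      have h1 := hq j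
      have h2 : ((j + 1 : ℕ) : ℤ) * ((n : ℤ) + 1) = -(((n : ℤ) + 1) * l) := by
        have : ((j + 1 : ℕ) : ℤ) = -l := by rw [hj]; rfl
        rw [this]; ring
      rw [h2, measureCoeff_neg, map_eq_zero] at h1
      exact h1
    · obtain ⟨j, hj⟩ := Int.eq_succ_of_zero_lt hl
      have h1 := hq j
      have h2 : ((j + 1 : ℕ) : ℤ) * ((n : ℤ) + 1) = ((n : ℤ) + 1) * l := by
        have : ((j + 1 : ℕ) : ℤ) = l := by rw [hj]; rfl
        rw [this]; ring
      rwa [h2] at h1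
  have key : ∀ G : UnitAddCircle → ℝ≥0∞, Measurable G →
      Function.Periodic G ((1 / ((n : ℝ) + 1) : ℝ) : UnitAddCircle) →
      ∫⁻ p, G (p.1 - p.2) ∂Q.prod Q = ∫⁻ x, G x ∂μ₀ := by
    intro G hG hper
    rw [← lintegral_eq_of_periodic (n := n) (ρ := (Q.prod Q).map fun p => p.1 - p.2)
      (fun l hl => by rw [measureCoeff_map_sub, hz l hl, zero_mul]) hG hper,
      lintegral_map hG hsub]
  have hi := h.interaction.integrable
  have hpos : ∫⁻ x, ENNReal.ofReal (W x) ∂μ₀ ≠ ⊤ := hi.lintegral_lt_top.ne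
  have hneg : ∫⁻ x, ENNReal.ofReal (-W x) ∂μ₀ ≠ ⊤ := hi.neg.lintegral_lt_top.ne
  have hmean := integral_eq_lintegral_pos_part_sub_lintegral_neg_part hi
  rw [h.interaction.mean_zero] at hmean
  rw [interactionEnergy, key (fun x => ENNReal.ofReal (W x))
    (ENNReal.measurable_ofReal.comp h.interaction.measurable)
    (fun x => by simp only [h.periodic x]), key (fun x => ENNReal.ofReal (-W x))
    (ENNReal.measurable_ofReal.comp h.interaction.measurable.neg)
    (fun x => by simp only [h.periodic x]),
    ereal_coe_sub_coe hpos hneg]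
  exact_mod_cast hmean.symm

lemma interactionEnergy_uniformDist (h : IsLogBounded n W) :
    interactionEnergy W uniformDist = 0 := by
  refine h.interactionEnergy_eq_zero fun j => ?_
  change measureCoeff μ₀ _ = 0
  rw [measureCoeff_haarAddCircle, if_neg]
  positivity

end IsLogBounded

/-! ### Concentrated measures and exclusion of the logarithmic kernel -/

lemma relEntropy_uniformDist : relEntropy uniformDist = 0 := klDiv_self _

lemma relEntropy_eq_zero_iff {q : ProbabilityMeasure UnitAddCircle} :
    relEntropy q = 0 ↔ q = uniformDist := by
  rw [relEntropy, klDiv_eq_zero_iff]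
  exact ⟨fun h => Subtype.ext h, fun h => congrArg _ h⟩

/-- The uniform distribution on the arc `‖θ‖ ≤ 1 / (6 m N)` has entropy `log (3 m N)` while its
Fourier coefficients at `j m`, `j ≤ N`, have modulus at least `1 / 2`. -/
lemma exists_arc {m N : ℕ} (hm : 0 < m) (hN : 0 < N) :
    ∃ (p : ProbabilityMeasure UnitAddCircle) (c : ℝ≥0), (p : Measure UnitAddCircle) ≤ c • μ₀ ∧
      relEntropy p ≠ ⊤ ∧ (relEntropy p).toReal = Real.log (3 * m * N) ∧
      ∀ j : ℕ, j ≤ N → 1 / 2 ≤ ‖measureCoeff p (j * (m : ℤ))‖ := by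
  have hm' : (1 : ℝ) ≤ m := by exact_mod_cast hm
  have hN' : (1 : ℝ) ≤ N := by exact_mod_cast hN
  have hmN : (1 : ℝ) ≤ m * N := one_le_mul_of_one_le_of_one_le hm' hN'
  -- With this radius the phase 2πjmy stays within π/3 for all j ≤ N, so its cosine is at least 1/2.
  set ε : ℝ := 1 / (6 * m * N) with hε
  have hε0 : 0 < ε := by positivity
  set A : Set UnitAddCircle := Metric.closedBall 0 ε with hA
  have hAm : MeasurableSet A := measurableSet_closedBall
  have hvol : μ₀ A = ENNReal.ofReal (2 * ε) := by
    have h1 : (volume : Measure UnitAddCircle) = μ₀ := by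
      rw [AddCircle.volume_eq_smul_haarAddCircle]; simp
    rw [← h1, hA, AddCircle.volume_closedBall, min_eq_right]
    rw [hε, mul_one_div, div_le_one (by positivity)]
    nlinarith
  have h0 : μ₀ A ≠ 0 := by rw [hvol]; simpa using hε0
  have hself : klDiv μ₀ μ₀ ≠ ⊤ := by simp
  obtain ⟨hk1, hk2⟩ := toReal_klDiv_cond hself hAm h0
  have hprob : IsProbabilityMeasure (ProbabilityTheory.cond μ₀ A) :=
    ProbabilityTheory.cond_isProbabilityMeasure h0
  refine ⟨⟨ProbabilityTheory.cond μ₀ A, hprob⟩, (μ₀ A)⁻¹.toNNReal, ?_, hk1, ?_, fun j hj => ?_⟩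
  · change ProbabilityTheory.cond μ₀ A ≤ _
    refine Measure.le_iff.2 fun s _ => ?_
    rw [ProbabilityTheory.cond_apply hAm, Measure.smul_apply, ENNReal.smul_def,
      ENNReal.coe_toNNReal (ENNReal.inv_ne_top.2 h0), smul_eq_mul]
    gcongr
    exact Set.inter_subset_right
  · refine hk2.trans ?_
    have : ∫ x in A, llr μ₀ μ₀ x ∂μ₀ = 0 := by
      rw [integral_eq_zero_of_ae]
      filter_upwards [ae_restrict_of_ae (llr_self μ₀)] with x hx using hx
    rw [this, mul_zero, zero_add, ENNReal.toReal_inv, hvol, ENNReal.toReal_ofReal (by positivity)]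
    congr 1
    rw [hε]; field_simp; norm_num
  · have hre : 1 / 2 ≤ (measureCoeff (ProbabilityTheory.cond μ₀ A) (j * (m : ℤ))).re := by
      have hae : ∀ᵐ x ∂(ProbabilityTheory.cond μ₀ A),
          (1 / 2 : ℝ) ≤ (fourier (-(j * (m : ℤ))) x : ℂ).re := by
        have hAae : ∀ᵐ x ∂(ProbabilityTheory.cond μ₀ A), x ∈ A :=
          ProbabilityTheory.ae_cond_mem hAm
        filter_upwards [hAae] with x hx
        obtain ⟨y, rfl, hy⟩ : ∃ y : ℝ, (y : UnitAddCircle) = x ∧ |y| ≤ ε := by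
          induction x using QuotientAddGroup.induction_on with
          | H y =>
            refine ⟨y - round y, ?_, ?_⟩
            · rw [AddCircle.coe_sub, sub_eq_self]
              exact AddCircle.coe_eq_zero_iff 1 |>.2 ⟨round y, by simp⟩
            · rw [← UnitAddCircle.norm_eq]
              simpa [hA] using hx
        rw [fourier_coe_apply]
        have harg : (2 * Real.pi * Complex.I * ((-((j : ℤ) * (m : ℤ)) : ℤ) : ℂ) * (y : ℂ) / (1 : ℝ))
            = ((-(2 * Real.pi * (j * m * y)) : ℝ) : ℂ) * Complex.I := by
          push_cast; ring
        rw [harg, Complex.exp_ofReal_mul_I_re, Real.cos_neg, ← Real.cos_abs,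
          ← Real.cos_pi_div_three]
        have hb : |2 * Real.pi * (j * m * y)| ≤ Real.pi / 3 := by
          rw [abs_mul, abs_mul (j * m : ℝ), abs_mul (j : ℝ), abs_of_pos Real.two_pi_pos,
            Nat.abs_cast, Nat.abs_cast]
          have hj' : (j : ℝ) ≤ N := by exact_mod_cast hj
          calc 2 * Real.pi * (j * m * |y|) ≤ 2 * Real.pi * (N * m * ε) := by gcongr
            _ = Real.pi / 3 := by rw [hε]; field_simp; norm_num
        exact Real.cos_le_cos_of_nonneg_of_le_pi (abs_nonneg _)
          (by linarith [Real.pi_pos]) hb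
      have h1 := integral_re (integrable_fourier (ProbabilityTheory.cond μ₀ A) (-(j * (m : ℤ))))
      simp only [RCLike.re_to_complex] at h1
      rw [measureCoeff, ← h1]
      have h2 := integral_mono_ae (integrable_const (1 / 2 : ℝ))
        (integrable_fourier (ProbabilityTheory.cond μ₀ A) (-(j * (m : ℤ)))).re hae
      simpa using h2
    exact hre.trans (Complex.re_le_norm _)

namespace IsLogBounded

variable {n : ℕ} {W : UnitAddCircle → ℝ}

/-- The entropy bound on the positive-definite part excludes `2 Ŵ(j(n+1)) = 1 / j` for all `j`. -/
lemma exists_two_mul_WHat_ne (h : IsLogBounded n W) :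
    ∃ j : ℕ, 2 * WHat W ((j + 1 : ℕ) * ((n : ℤ) + 1)) ≠ 1 / ((j : ℝ) + 1) := by
  by_contra! hall
  -- The arc has energy at least (1/4) log(N + 1) and entropy about log N. Any coupling above 4
  -- gives a contradiction; 8 makes the left side 2 log(N + 1).
  obtain ⟨C, hC⟩ := h.exists_energy_bound 8
  have hlog : ∀ N : ℕ, 0 < N → Real.log (N + 1) ≤ Real.log (3 * (n + 1 : ℕ)) + C := by
    intro N hN
    obtain ⟨p, c, hpc, hH, hHlog, hcoeff⟩ := exists_arc n.succ_pos hN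
    have h1 := hC p _ hH (h.interactionEnergy_eq hpc)
    have h2 : ∑ j ∈ Finset.range N, 1 / ((j : ℝ) + 1) * (1 / 4)
        ≤ ∫ x : UnitAddCircle × UnitAddCircle, W (x.1 - x.2)
          ∂(p : Measure UnitAddCircle).prod (p : Measure UnitAddCircle) := by
      refine le_trans (Finset.sum_le_sum fun j hj => ?_)
        (sum_le_hasSum (Finset.range N) (fun j _ => ?_) (h.hasSum_energy_self hpc))
      · rw [hall j]
        have h3 := hcoeff (j + 1) (Finset.mem_range.1 hj)
        have h4 : (1 / 4 : ℝ) ≤ ‖measureCoeff p ((j + 1 : ℕ) * ((n : ℤ) + 1))‖ ^ 2 := by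
          have := pow_le_pow_left₀ (by norm_num) h3 2
          norm_num at this ⊢
          exact this
        gcongr
      · rw [hall j]; positivity
    have h3 : Real.log (N + 1) ≤ ∑ j ∈ Finset.range N, 1 / ((j : ℝ) + 1) := by
      have := log_add_one_le_harmonic N
      simpa [harmonic, one_div] using this
    rw [← Finset.sum_mul] at h2
    have h4 : Real.log (3 * (n + 1 : ℕ) * N) ≤ Real.log (3 * (n + 1 : ℕ)) + Real.log (N + 1) := by
      have hN' : (0 : ℝ) < N := by exact_mod_cast hN
      rw [Real.log_mul (by positivity) hN'.ne']
      gcongr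
      linarith
    rw [hHlog] at h1
    have h8 : (((8 : ℝ≥0) : ℝ≥0) : ℝ) = 8 := rfl
    rw [h8] at h1
    linarith
  have ht : Tendsto (fun N : ℕ => Real.log ((N : ℝ) + 1)) atTop atTop :=
    Real.tendsto_log_atTop.comp (tendsto_atTop_add_const_right _ _ tendsto_natCast_atTop_atTop)
  obtain ⟨N, hN1, hN2⟩ := ((ht.eventually_gt_atTop (Real.log (3 * (n + 1 : ℕ)) + C)).and
    (eventually_gt_atTop 0)).exists
  exact absurd (hlog N hN2) (not_le.2 hN1)

/-- Only the uniform distribution has energy equal to its entropy. -/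
lemma eq_uniformDist_of_entropy_le (h : IsLogBounded n W) {q : ProbabilityMeasure UnitAddCircle}
    (hH : relEntropy q ≠ ⊤) (hE : ((relEntropy q).toReal : EReal) ≤ interactionEnergy W q) :
    q = uniformDist := by
  obtain ⟨h1, h2⟩ := h.equality_case hH hE
  by_cases ha : measureCoeff q ((n : ℤ) + 1) = 0
  · have h3 := h.interactionEnergy_eq_zero (q := q) fun j => by
      rw [h1 j, ha, zero_pow j.succ_ne_zero]
    rw [h3] at hE
    have h4 : (relEntropy q).toReal ≤ 0 := by exact_mod_cast hE
    have h5 := le_antisymm h4 ENNReal.toReal_nonneg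
    exact relEntropy_eq_zero_iff.1 ((ENNReal.toReal_eq_zero_iff _).1 h5 |>.resolve_right hH)
  · obtain ⟨j, hj⟩ := h.exists_two_mul_WHat_ne
    refine absurd (h2 j) (mul_ne_zero (sub_ne_zero.2 hj.symm) (pow_ne_zero 2 ?_))
    rw [h1 j]
    exact norm_ne_zero_iff.2 (pow_ne_zero _ ha)

/-! ### Uniqueness of the minimizer up to the critical coupling -/

lemma relEntropy_coe {q : ProbabilityMeasure UnitAddCircle} (hH : relEntropy q ≠ ⊤) :
    ((relEntropy q : ℝ≥0∞) : EReal) = ((relEntropy q).toReal : EReal) :=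
  (EReal.coe_ennreal_toReal hH).symm

lemma freeEnergy_eq {K e : ℝ} {q : ProbabilityMeasure UnitAddCircle}
    (hH : relEntropy q ≠ ⊤) (hE : interactionEnergy W q = e) :
    freeEnergy W K q = (((relEntropy q).toReal - K * e : ℝ) : EReal) := by
  rw [freeEnergy, if_neg hH, hE, relEntropy_coe hH]
  rfl

lemma freeEnergy_uniformDist (h : IsLogBounded n W) (K : ℝ) :
    freeEnergy W K uniformDist = 0 := by
  rw [freeEnergy_eq (e := 0) (by simp [relEntropy_uniformDist]) h.interactionEnergy_uniformDist]
  simp [relEntropy_uniformDist]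

/-- A measure of finite free energy has finite entropy, and a real energy unless `K = 0`. -/
lemma exists_energy_of_freeEnergy_lt_top (h : IsLogBounded n W) {K : ℝ} (hK : 0 < K)
    {q : ProbabilityMeasure UnitAddCircle} (hF : freeEnergy W K q < ⊤) :
    relEntropy q ≠ ⊤ ∧ ∃ e : ℝ, interactionEnergy W q = e ∧ e ≤ (relEntropy q).toReal := by
  have hH : relEntropy q ≠ ⊤ := by
    intro hH; simp [freeEnergy, hH] at hF
  refine ⟨hH, ?_⟩
  have hle := h.interactionEnergy_le hH
  have hE : interactionEnergy W q ≠ ⊥ := by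
    intro hE
    rw [freeEnergy, if_neg hH, hE, EReal.coe_mul_bot_of_pos hK, relEntropy_coe hH] at hF
    simp at hF
  have htop : interactionEnergy W q ≠ ⊤ := (hle.trans_lt (EReal.coe_lt_top _)).ne
  refine ⟨_, (EReal.coe_toReal htop hE).symm, ?_⟩
  rwa [← EReal.coe_toReal htop hE, EReal.coe_le_coe_iff] at hle

/-- From H ≤ K E and H ≥ 0 one gets E ≥ 0, so H ≤ E and the equality case applies. Nonnegativity of
F_K, uniqueness at K ≤ 1 and the identification of cluster points as K ↓ 1 all rest on this. -/
lemma eq_uniformDist_of_freeEnergy_nonpos (h : IsLogBounded n W) {K : ℝ} (hK0 : 0 ≤ K)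
    (hK1 : K ≤ 1) {q : ProbabilityMeasure UnitAddCircle} (hF : freeEnergy W K q ≤ 0) :
    q = uniformDist := by
  -- For K = 0 the energy may be −∞, but the product with 0 is 0 and the free energy is just the
  -- entropy.
  rcases hK0.eq_or_lt with rfl | hK
  · have hH : relEntropy q ≠ ⊤ := by
      intro hH; simp [freeEnergy, hH] at hF
    rw [freeEnergy, if_neg hH] at hF
    simp only [EReal.coe_zero, zero_mul, sub_zero] at hF
    refine relEntropy_eq_zero_iff.1 (le_antisymm ?_ bot_le)
    exact_mod_cast hF
  · obtain ⟨hH, e, he, hle⟩ := h.exists_energy_of_freeEnergy_lt_top hK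
      (hF.trans_lt EReal.zero_lt_top)
    rw [freeEnergy_eq hH he] at hF
    have h1 : (relEntropy q).toReal - K * e ≤ 0 := by exact_mod_cast hF
    refine h.eq_uniformDist_of_entropy_le hH ?_
    rw [he, EReal.coe_le_coe_iff]
    have h2 : 0 ≤ (relEntropy q).toReal := ENNReal.toReal_nonneg
    have h3 : 0 ≤ e := by
      by_contra! h4
      nlinarith
    nlinarith

lemma freeEnergy_nonneg (h : IsLogBounded n W) {K : ℝ} (hK0 : 0 ≤ K) (hK1 : K ≤ 1)
    (q : ProbabilityMeasure UnitAddCircle) : 0 ≤ freeEnergy W K q := by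
  by_contra! hF
  rw [h.eq_uniformDist_of_freeEnergy_nonpos hK0 hK1 hF.le, h.freeEnergy_uniformDist] at hF
  exact lt_irrefl _ hF

lemma isUniqueGlobalMinimizer_uniformDist (h : IsLogBounded n W) {K : ℝ} (hK0 : 0 ≤ K)
    (hK1 : K ≤ 1) : IsUniqueGlobalMinimizer W K uniformDist := by
  refine ⟨fun p => ?_, fun p hp => ?_⟩
  · rw [h.freeEnergy_uniformDist]
    exact h.freeEnergy_nonneg hK0 hK1 p
  · refine h.eq_uniformDist_of_freeEnergy_nonpos hK0 hK1 ?_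
    rw [← h.freeEnergy_uniformDist K]
    exact hp uniformDist

end IsLogBounded

/-! ### Instability of the uniform distribution above the critical coupling -/

lemma klFun_one_add_le {x : ℝ} (hx : |x| ≤ 1 / 2) :
    klFun (1 + x) ≤ x ^ 2 / 2 + 4 * |x| ^ 3 := by
  have h1 := Real.abs_log_sub_add_sum_range_le (x := -x) (by rw [abs_neg]; linarith) 2
  simp only [Finset.sum_range_succ, Finset.sum_range_zero, abs_neg, sub_neg_eq_add] at h1
  have h2 : |x| ^ (2 + 1) / (1 - |x|) ≤ 2 * |x| ^ 3 := by
    rw [div_le_iff₀ (by linarith), show 2 + 1 = 3 from rfl]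
    nlinarith [pow_nonneg (abs_nonneg x) 3]
  have h3 := (le_abs_self _).trans (h1.trans h2)
  norm_num at h3
  rw [klFun_apply]
  have hx' := abs_le.1 hx
  have h4 : Real.log (1 + x) ≤ x - x ^ 2 / 2 + 2 * |x| ^ 3 := by linarith
  have h5 : (1 + x) * Real.log (1 + x) ≤ (1 + x) * (x - x ^ 2 / 2 + 2 * |x| ^ 3) :=
    mul_le_mul_of_nonneg_left h4 (by linarith)
  have h6 : |x| ^ 3 = |x ^ 3| := (abs_pow x 3).symm
  have h7 := neg_abs_le (x ^ 3)
  have h8 : 0 ≤ |x| ^ 3 := by positivity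
  nlinarith

/-- The density `1 + ε cos (2 π m θ)`. -/
def cosDensity (m : ℤ) (ε : ℝ) (θ : UnitAddCircle) : ℝ := 1 + ε * (fourier m θ : ℂ).re

lemma continuous_cosDensity (m : ℤ) (ε : ℝ) : Continuous (cosDensity m ε) := by
  unfold cosDensity; fun_prop

lemma abs_mul_re_fourier_le {ε : ℝ} (hε : 0 ≤ ε) (m : ℤ) (θ : UnitAddCircle) :
    |ε * (fourier m θ : ℂ).re| ≤ ε := by
  rw [abs_mul, abs_of_nonneg hε]
  refine mul_le_of_le_one_right hε ((Complex.abs_re_le_norm _).trans ?_)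
  rw [fourier_apply, Circle.norm_coe]

lemma coe_cosDensity (m : ℤ) (ε : ℝ) (θ : UnitAddCircle) :
    (cosDensity m ε θ : ℂ) = 1 + ε / 2 * (fourier m θ + fourier (-m) θ) := by
  rw [cosDensity, fourier_neg, Complex.add_conj]
  push_cast
  ring

lemma integral_fourier_mul_cosDensity (m k : ℤ) (ε : ℝ) :
    ∫ θ, (fourier k θ : ℂ) * cosDensity m ε θ ∂μ₀
      = (if k = 0 then 1 else 0) + ε / 2 * ((if k + m = 0 then 1 else 0)
        + if k + -m = 0 then 1 else 0) := by
  have h1 : ∀ θ, (fourier k θ : ℂ) * cosDensity m ε θ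
      = fourier k θ + ε / 2 * (fourier (k + m) θ + fourier (k + -m) θ) := by
    intro θ
    rw [coe_cosDensity, fourier_add, fourier_add]
    ring
  have h2 : Integrable (fun θ => (fourier (k + m) θ : ℂ) + fourier (k + -m) θ) μ₀ :=
    (integrable_fourier _ _).add (integrable_fourier _ _)
  simp only [h1]
  rw [integral_add (integrable_fourier _ _) (h2.const_mul _), integral_const_mul, integral_add
    (integrable_fourier _ _) (integrable_fourier _ _), integral_fourier, integral_fourier,
    integral_fourier]

lemma integral_re_fourier_sq {m : ℤ} (hm : m ≠ 0) :
    Integrable (fun θ : UnitAddCircle => (fourier m θ : ℂ).re ^ 2) μ₀ ∧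
      ∫ θ, (fourier m θ : ℂ).re ^ 2 ∂μ₀ = 1 / 2 := by
  have h1 : ∀ θ : UnitAddCircle, (fourier m θ : ℂ).re ^ 2
      = 1 / 2 + 1 / 2 * (fourier (m + m) θ : ℂ).re := by
    intro θ
    rw [fourier_add, Complex.mul_re]
    have : ‖(fourier m θ : ℂ)‖ ^ 2 = 1 := by rw [fourier_apply, Circle.norm_coe, one_pow]
    rw [← Complex.normSq_eq_norm_sq, Complex.normSq_apply] at this
    linarith
  have hi : Integrable (fun θ : UnitAddCircle => (fourier (m + m) θ : ℂ).re) μ₀ :=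
    (integrable_fourier μ₀ (m + m)).re
  have h2 := integral_re (integrable_fourier μ₀ (m + m))
  simp only [RCLike.re_to_complex] at h2
  simp only [h1]
  refine ⟨(integrable_const _).add (hi.const_mul _), ?_⟩
  rw [integral_add (integrable_const _) (hi.const_mul _), integral_const_mul, h2,
    integral_fourier, if_neg (by omega)]
  simp

/-- The trial density 1 + ε cos(2πmθ): the mean 1/2 of cos² and `klFun (1 + x)` ≈ x²/2 give the
leading entropy ε²/4, and its only nonzero frequencies are ±m. -/
lemma exists_cos_measure {m : ℤ} (hm : 0 < m) {ε : ℝ} (hε0 : 0 ≤ ε) (hε : ε ≤ 1 / 2) :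
    ∃ (q : ProbabilityMeasure UnitAddCircle) (c : ℝ≥0), (q : Measure UnitAddCircle) ≤ c • μ₀ ∧
      relEntropy q ≠ ⊤ ∧ (relEntropy q).toReal ≤ ε ^ 2 / 4 + 4 * ε ^ 3 ∧
      ∀ j : ℕ, measureCoeff q ((j + 1 : ℕ) * m) = if j = 0 then (ε : ℂ) / 2 else 0 := by
  have hcont := continuous_cosDensity m ε
  have hb := abs_mul_re_fourier_le hε0 m
  have hnn : ∀ θ, 0 ≤ cosDensity m ε θ := fun θ => by
    have := (abs_le.1 (hb θ)).1
    rw [cosDensity]; linarith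
  have hle2 : ∀ θ, cosDensity m ε θ ≤ 2 := fun θ => by
    have := (abs_le.1 (hb θ)).2
    rw [cosDensity]; linarith
  have hint : Integrable (cosDensity m ε) μ₀ :=
    Integrable.of_bound hcont.aestronglyMeasurable 2 (ae_of_all _ fun θ => by
      rw [Real.norm_of_nonneg (hnn θ)]; exact hle2 θ)
  have hmeas : Measurable fun θ => ENNReal.ofReal (cosDensity m ε θ) :=
    ENNReal.measurable_ofReal.comp hcont.measurable
  set Q : Measure UnitAddCircle := Measure.withDensity μ₀ fun θ => ENNReal.ofReal (cosDensity m ε θ)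
    with hQ
  have hone : ∫ θ, cosDensity m ε θ ∂μ₀ = 1 := by
    have h1 := integral_fourier_mul_cosDensity m 0 ε
    simp only [fourier_zero, one_mul, integral_complex_ofReal, zero_add, if_true, hm.ne',
      neg_eq_zero, if_false, add_zero, mul_zero] at h1
    exact_mod_cast h1
  have hprob : IsProbabilityMeasure Q := ⟨by
    rw [hQ, withDensity_apply _ MeasurableSet.univ, setLIntegral_univ,
      ← ofReal_integral_eq_lintegral_ofReal hint (ae_of_all _ hnn), hone, ENNReal.ofReal_one]⟩
  have hac : Q ≪ μ₀ := withDensity_absolutelyContinuous _ _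
  have hrn : ∀ᵐ θ ∂μ₀, (Q.rnDeriv μ₀ θ).toReal = cosDensity m ε θ := by
    filter_upwards [Measure.rnDeriv_withDensity μ₀ hmeas] with θ hθ
    rw [hθ, ENNReal.toReal_ofReal (hnn θ)]
  have hkl_le : ∀ θ, klFun (cosDensity m ε θ)
      ≤ ε ^ 2 / 2 * (fourier m θ : ℂ).re ^ 2 + 4 * ε ^ 3 := by
    intro θ
    refine (klFun_one_add_le ((hb θ).trans hε)).trans ?_
    rw [mul_pow, div_eq_mul_one_div (ε ^ 2 * _), mul_right_comm, ← div_eq_mul_one_div]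
    have := pow_le_pow_left₀ (abs_nonneg _) (hb θ) 3
    linarith
  have hklint : Integrable (fun θ => klFun (cosDensity m ε θ)) μ₀ := by
    have hc : Continuous fun θ => klFun (cosDensity m ε θ) := continuous_klFun.comp hcont
    obtain ⟨B, hB⟩ := isCompact_univ.exists_bound_of_continuousOn hc.continuousOn
    exact Integrable.of_bound hc.aestronglyMeasurable B (ae_of_all _ fun θ => hB θ (Set.mem_univ _))
  refine ⟨⟨Q, hprob⟩, 2, ?_, ?_, ?_, fun j => ?_⟩
  · change Q ≤ _
    refine Measure.le_iff.2 fun s hs => ?_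
    rw [hQ, withDensity_apply _ hs, Measure.smul_apply, ENNReal.smul_def, smul_eq_mul,
      ← setLIntegral_const]
    refine lintegral_mono fun θ => ?_
    rw [show ((2 : ℝ≥0) : ℝ≥0∞) = ENNReal.ofReal 2 by simp]
    exact ENNReal.ofReal_le_ofReal (hle2 θ)
  · change klDiv Q μ₀ ≠ ⊤
    refine klDiv_ne_top hac ((integrable_klFun_rnDeriv_iff hac).1 (hklint.congr ?_))
    filter_upwards [hrn] with θ hθ
    rw [hθ]
  · change (klDiv Q μ₀).toReal ≤ _
    obtain ⟨hsqint, hre⟩ := integral_re_fourier_sq hm.ne'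
    have hbint : Integrable (fun θ : UnitAddCircle =>
        ε ^ 2 / 2 * (fourier m θ : ℂ).re ^ 2 + 4 * ε ^ 3) μ₀ :=
      (hsqint.const_mul _).add (integrable_const _)
    rw [toReal_klDiv_eq_integral_klFun hac]
    calc ∫ θ, klFun (Q.rnDeriv μ₀ θ).toReal ∂μ₀ = ∫ θ, klFun (cosDensity m ε θ) ∂μ₀ :=
          integral_congr_ae (hrn.mono fun θ hθ => by simp only [hθ])
      _ ≤ ∫ θ, (ε ^ 2 / 2 * (fourier m θ : ℂ).re ^ 2 + 4 * ε ^ 3) ∂μ₀ :=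
          integral_mono hklint hbint hkl_le
      _ = ε ^ 2 / 4 + 4 * ε ^ 3 := by
          rw [integral_add (hsqint.const_mul _) (integrable_const _), integral_const_mul, hre]
          simp
          ring
  · change measureCoeff Q _ = _
    have h1 : measureCoeff Q ((j + 1 : ℕ) * m)
        = ∫ θ, (fourier (-((j + 1 : ℕ) * m)) θ : ℂ) * cosDensity m ε θ ∂μ₀ := by
      rw [measureCoeff, hQ, integral_withDensity_eq_integral_toReal_smul hmeas
        (ae_of_all _ fun θ => ENNReal.ofReal_lt_top)]
      refine integral_congr_ae (ae_of_all _ fun θ => ?_)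
      simp only
      rw [ENNReal.toReal_ofReal (hnn θ), Complex.real_smul, mul_comm]
    rw [h1, integral_fourier_mul_cosDensity]
    have hA : ¬ (-(((j + 1 : ℕ) : ℤ) * m) = 0) := by
      rw [neg_eq_zero]; positivity
    have hB : ¬ (-(((j + 1 : ℕ) : ℤ) * m) + -m = 0) := by
      have : 0 < ((j + 1 : ℕ) : ℤ) * m := by positivity
      omega
    have hC : (-(((j + 1 : ℕ) : ℤ) * m) + m = 0) ↔ j = 0 := by
      have : -(((j + 1 : ℕ) : ℤ) * m) + m = -((j : ℤ) * m) := by push_cast; ring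
      rw [this, neg_eq_zero, mul_eq_zero, or_iff_left hm.ne']
      omega
    rw [if_neg hA, if_neg hB]
    simp only [hC]
    split_ifs <;> simp

/-- The uniform distribution is not a minimizer above the critical coupling. -/
lemma IsLogBounded.exists_freeEnergy_neg {n : ℕ} {W : UnitAddCircle → ℝ} (h : IsLogBounded n W)
    {K : ℝ} (hK : 1 < K) : ∃ q, freeEnergy W K q < 0 := by
  -- The bound (K − 1)/16 lets the gain (K − 1)ε²/4 beat the cubic entropy error 4ε³; the bound 1/2
  -- keeps the density positive.
  obtain ⟨ε, hε0, hε1⟩ : ∃ ε : ℝ, 0 < ε ∧ ε < min (1 / 2) ((K - 1) / 16) :=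
    exists_between (lt_min (by norm_num) (by linarith))
  obtain ⟨q, c, hc, hH, hle, hcoeff⟩ := exists_cos_measure (m := (n : ℤ) + 1) (by positivity)
    hε0.le (hε1.le.trans (min_le_left _ _))
  have hsum := h.hasSum_energy_self hc
  have hE : ∫ x : UnitAddCircle × UnitAddCircle, W (x.1 - x.2)
      ∂(q : Measure UnitAddCircle).prod (q : Measure UnitAddCircle) = ε ^ 2 / 4 := by
    refine hsum.unique ?_
    have h0 : ε ^ 2 / 4 = 2 * WHat W ((0 + 1 : ℕ) * ((n : ℤ) + 1))
        * ‖measureCoeff q ((0 + 1 : ℕ) * ((n : ℤ) + 1))‖ ^ 2 := by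
      rw [hcoeff 0]
      simp only [zero_add, Nat.cast_one, one_mul, h.norm, if_true, norm_div, Complex.norm_real,
        Real.norm_eq_abs, div_pow, sq_abs]
      norm_num
    rw [h0]
    refine hasSum_single 0 fun j hj => ?_
    rw [hcoeff j, if_neg hj]
    simp
  refine ⟨q, ?_⟩
  rw [IsLogBounded.freeEnergy_eq hH (h.interactionEnergy_eq hc), hE]
  have h2 := hε1.trans_le (min_le_right _ _)
  have h3 : ε ^ 2 / 4 + 4 * ε ^ 3 < K * (ε ^ 2 / 4) := by
    have : 0 < ε ^ 2 := by positivity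
    nlinarith
  have : (relEntropy q).toReal - K * (ε ^ 2 / 4) < 0 := by linarith
  exact_mod_cast this

/-! ### Variational formula and lower semicontinuity of the entropy -/

section Semicontinuity

variable {q : Measure UnitAddCircle} [IsProbabilityMeasure q] {C : ℝ}

/-- The variational bound for continuous test functions extends to bounded measurable ones. -/
lemma integral_le_of_forall_continuous
    (h : ∀ u : BoundedContinuousFunction UnitAddCircle ℝ,
      ∫ x, u x ∂q ≤ C + ∫ x, Real.exp (u x) ∂μ₀ - 1)
    {u : UnitAddCircle → ℝ} (hu : Measurable u) {M : ℝ} (hM : ∀ x, |u x| ≤ M) :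
    ∫ x, u x ∂q ≤ C + ∫ x, Real.exp (u x) ∂μ₀ - 1 := by
  have hM0 : 0 ≤ M := (abs_nonneg _).trans (hM 0)
  suffices hsuff : ∀ ε > 0, ∫ x, u x ∂q
      ≤ C + ∫ x, Real.exp (u x) ∂μ₀ - 1 + ε * (1 + Real.exp M) by
    refine le_of_forall_pos_le_add fun ε hε => ?_
    have h1 : 0 < 1 + Real.exp M := by positivity
    have := hsuff (ε / (1 + Real.exp M)) (by positivity)
    rwa [div_mul_cancel₀ _ h1.ne'] at this
  intro ε hε
  -- Approximating in L¹ of the sum q + μ₀ controls both sides at once, before q is known to be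
  -- absolutely continuous. Clipping g to [−M, M] then does not increase its distance to u.
  obtain ⟨g, hg, -⟩ := (integrable_of_abs_le hu hM
    (q + μ₀)).exists_boundedContinuous_integral_sub_le hε
  let v : BoundedContinuousFunction UnitAddCircle ℝ := BoundedContinuousFunction.mkOfCompact
    ⟨fun x => max (-M) (min M (g x)), by fun_prop⟩
  have hv : ∀ x, v x = max (-M) (min M (g x)) := fun x => rfl
  have hvm : Measurable v := v.continuous.measurable
  have hvM : ∀ x, |v x| ≤ M := fun x => by
    rw [hv, abs_le]
    exact ⟨le_max_left _ _, max_le (by linarith) (min_le_left _ _)⟩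
  have hclip : ∀ x, |u x - v x| ≤ ‖u x - g x‖ := fun x => by
    have hux : u x = max (-M) (min M (u x)) := by
      rw [min_eq_right (abs_le.1 (hM x)).2, max_eq_right (abs_le.1 (hM x)).1]
    rw [hv, Real.norm_eq_abs]
    conv_lhs => rw [hux]
    exact (abs_max_sub_max_le_max _ _ _ _).trans (max_le (by simp)
      ((abs_min_sub_min_le_max _ _ _ _).trans
      (max_le (by simp) le_rfl)))
  have hdm : Measurable fun x => u x - v x := hu.sub hvm
  have hdM : ∀ x, |u x - v x| ≤ M + M := fun x =>
    (abs_sub _ _).trans (add_le_add (hM x) (hvM x))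
  have hdint : ∀ (τ : Measure UnitAddCircle) [IsFiniteMeasure τ],
      Integrable (fun x => |u x - v x|) τ := fun τ _ => (integrable_of_abs_le hdm hdM τ).abs
  have hsum : ∫ x, |u x - v x| ∂q + ∫ x, |u x - v x| ∂μ₀ ≤ ε := by
    rw [← integral_add_measure (hdint q) (hdint μ₀)]
    refine le_trans (integral_mono (hdint _) ?_ hclip) hg
    exact ((integrable_of_abs_le hu hM _).sub (g.integrable _)).norm
  have hq0 : 0 ≤ ∫ x, |u x - v x| ∂q := integral_nonneg fun _ => abs_nonneg _
  have hμ0 : 0 ≤ ∫ x, |u x - v x| ∂μ₀ := integral_nonneg fun _ => abs_nonneg _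
  have h1 : ∫ x, u x ∂q ≤ ∫ x, v x ∂q + ∫ x, |u x - v x| ∂q := by
    rw [← integral_add (integrable_of_abs_le hvm hvM q) (hdint q)]
    refine integral_mono (integrable_of_abs_le hu hM q)
      ((integrable_of_abs_le hvm hvM q).add (hdint q)) fun x => ?_
    have := le_abs_self (u x - v x)
    simp only
    linarith
  have h2 : ∫ x, Real.exp (v x) ∂μ₀
      ≤ ∫ x, Real.exp (u x) ∂μ₀ + Real.exp M * ∫ x, |u x - v x| ∂μ₀ := by
    rw [← integral_const_mul, ← integral_add (integrable_exp_of_abs_le hu hM μ₀)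
      ((hdint μ₀).const_mul _)]
    refine integral_mono (integrable_exp_of_abs_le hvm hvM μ₀)
      ((integrable_exp_of_abs_le hu hM μ₀).add ((hdint μ₀).const_mul _)) fun x => ?_
    have h3 : Real.exp (u x) = Real.exp (v x) * Real.exp (u x - v x) := by
      rw [← Real.exp_add]; ring_nf
    have h4 := Real.add_one_le_exp (u x - v x)
    have h5 := mul_le_mul_of_nonneg_left h4 (Real.exp_nonneg (v x))
    have h6 := neg_abs_le (u x - v x)
    have h7 : Real.exp (v x) ≤ Real.exp M := Real.exp_le_exp.2 (abs_le.1 (hvM x)).2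
    have h8 := mul_le_mul_of_nonneg_right h7 (abs_nonneg (u x - v x))
    have h9 := mul_le_mul_of_nonneg_left h6 (Real.exp_nonneg (v x))
    simp only
    rw [h3]
    linarith
  have h3 := h v
  have h4 : Real.exp M * ∫ x, |u x - v x| ∂μ₀ ≤ Real.exp M * ε :=
    mul_le_mul_of_nonneg_left (by linarith) (Real.exp_nonneg _)
  linarith

lemma absolutelyContinuous_of_forall_continuous
    (h : ∀ u : BoundedContinuousFunction UnitAddCircle ℝ,
      ∫ x, u x ∂q ≤ C + ∫ x, Real.exp (u x) ∂μ₀ - 1) : q ≪ μ₀ := by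
  refine Measure.AbsolutelyContinuous.mk fun s hs hs0 => ?_
  by_contra hne
  have hpos : 0 < q.real s := ENNReal.toReal_pos hne (measure_ne_top _ _)
  have hC : 0 ≤ C := by simpa using h 0
  -- On a Haar-null set s the function t·1_s has exponential integral 1, so the bound would give t
  -- q(s) = C + 1 ≤ C.
  set t : ℝ := (C + 1) / q.real s with ht
  have ht0 : 0 ≤ t := by positivity
  have h1 := integral_le_of_forall_continuous h (u := s.indicator fun _ => t) (M := t)
    (measurable_const.indicator hs) (fun x => by
      by_cases hx : x ∈ s <;> simp [hx, ht0, abs_of_nonneg])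
  have h2 : ∫ x, Real.exp (s.indicator (fun _ => t) x) ∂μ₀ = 1 := by
    have : (fun x => Real.exp (s.indicator (fun _ => t) x)) =ᵐ[μ₀] fun _ => 1 := by
      filter_upwards [measure_eq_zero_iff_ae_notMem.1 hs0] with x hx
      simp [hx]
    rw [integral_congr_ae this]; simp
  rw [h2, integral_indicator_const _ hs, smul_eq_mul, ht, mul_div_cancel₀ _ hpos.ne'] at h1
  linarith

/-- The truncation of `x` to `[1 / (n + 1), n + 1]`. -/
def clip (n : ℕ) (x : ℝ) : ℝ := max (1 / ((n : ℝ) + 1)) (min ((n : ℝ) + 1) x)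

lemma one_div_le_clip (n : ℕ) (x : ℝ) : 1 / ((n : ℝ) + 1) ≤ clip n x := le_max_left _ _

lemma clip_pos (n : ℕ) (x : ℝ) : 0 < clip n x :=
  lt_of_lt_of_le (by positivity) (one_div_le_clip n x)

lemma clip_le (n : ℕ) (x : ℝ) : clip n x ≤ (n : ℝ) + 1 := by
  refine max_le ?_ (min_le_left _ _)
  have : (0 : ℝ) ≤ n := n.cast_nonneg
  rw [div_le_iff₀ (by positivity)]
  nlinarith

lemma abs_log_clip_le (n : ℕ) (x : ℝ) : |Real.log (clip n x)| ≤ Real.log ((n : ℝ) + 1) := by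
  rw [abs_le]
  constructor
  · rw [← Real.log_inv, ← one_div]
    exact Real.log_le_log (by positivity) (one_div_le_clip n x)
  · exact Real.log_le_log (clip_pos n x) (clip_le n x)

/-- With c = `clip n x` this equals `klFun c` + (x − c) log c, and wherever clipping is active log c
has the sign of x − c. Fatou's lemma needs this nonnegativity. -/
lemma mul_log_clip_nonneg {x : ℝ} (n : ℕ) : 0 ≤ x * Real.log (clip n x) - clip n x + 1 := by
  have h1 := klFun_nonneg (clip_pos n x).le
  rw [klFun_apply] at h1
  have hn1 : 1 ≤ (n : ℝ) + 1 := by simp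
  have h2 : 0 ≤ (x - clip n x) * Real.log (clip n x) := by
    rcases le_total ((n : ℝ) + 1) x with hx | hx
    · have : clip n x = (n : ℝ) + 1 := by
        rw [clip, min_eq_left hx, max_eq_right]
        exact (one_div_le_clip n x).trans (clip_le n x)
      rw [this]
      exact mul_nonneg (by linarith) (Real.log_nonneg hn1)
    · rcases le_total (1 / ((n : ℝ) + 1)) x with hx' | hx'
      · have : clip n x = x := by rw [clip, min_eq_right hx, max_eq_right hx']
        rw [this]; simp
      · have : clip n x = 1 / ((n : ℝ) + 1) := by rw [clip, min_eq_right hx, max_eq_left hx']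
        rw [this]
        refine mul_nonneg_of_nonpos_of_nonpos (by linarith) (Real.log_nonpos (by positivity) ?_)
        rw [div_le_one (by positivity)]
        exact hn1
  linarith

lemma tendsto_mul_log_clip {x : ℝ} (hx : 0 ≤ x) :
    Tendsto (fun n : ℕ => x * Real.log (clip n x) - clip n x + 1) atTop (𝓝 (klFun x)) := by
  rw [klFun_apply]
  rcases hx.eq_or_lt with rfl | hx
  · have h1 : ∀ n : ℕ, clip n 0 = 1 / ((n : ℝ) + 1) := fun n => by
      rw [clip, min_eq_right (by positivity), max_eq_left (by positivity)]
    simp only [h1, zero_mul]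
    have := (tendsto_one_div_add_atTop_nhds_zero_nat (𝕜 := ℝ)).const_sub 0 |>.add_const 1
    simpa using this
  · refine tendsto_const_nhds.congr' ?_
    have h1 := (tendsto_one_div_add_atTop_nhds_zero_nat (𝕜 := ℝ)).eventually_lt_const hx
    have h2 := tendsto_natCast_atTop_atTop (R := ℝ) |>.eventually_ge_atTop x
    filter_upwards [h1, h2] with n hn1 hn2
    rw [clip, min_eq_right (by linarith), max_eq_right hn1.le]
    ring

lemma measurable_clip (n : ℕ) : Measurable (clip n) := by
  unfold clip; fun_prop

/-- The Donsker-Varadhan variational formula: the entropy is at most the supremum over continuous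
test functions. -/
lemma klDiv_le_of_forall_continuous
    (h : ∀ u : BoundedContinuousFunction UnitAddCircle ℝ,
      ∫ x, u x ∂q ≤ C + ∫ x, Real.exp (u x) ∂μ₀ - 1) : klDiv q μ₀ ≤ ENNReal.ofReal C := by
  have hac := absolutelyContinuous_of_forall_continuous h
  set f : UnitAddCircle → ℝ := fun x => (q.rnDeriv μ₀ x).toReal with hf
  have hfm : Measurable f := (Measure.measurable_rnDeriv _ _).ennreal_toReal
  have hf0 : ∀ x, 0 ≤ f x := fun x => ENNReal.toReal_nonneg
  have hcm : ∀ n, Measurable fun x => clip n (f x) := fun n => (measurable_clip n).comp hfm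
  have hum : ∀ n, Measurable fun x => Real.log (clip n (f x)) := fun n => (hcm n).log
  have hm : ∀ n, Measurable fun x =>
      ENNReal.ofReal (f x * Real.log (clip n (f x)) - clip n (f x) + 1) := fun n =>
    ENNReal.measurable_ofReal.comp (((hfm.mul (hum n)).sub (hcm n)).add_const 1)
  have hlim : ∀ x, liminf (fun n => ENNReal.ofReal
      (f x * Real.log (clip n (f x)) - clip n (f x) + 1)) atTop = ENNReal.ofReal (klFun (f x)) :=
    fun x => ((ENNReal.continuous_ofReal.tendsto _).comp
      (tendsto_mul_log_clip (hf0 x))).liminf_eq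
  rw [klDiv_eq_lintegral_klFun_of_ac hac]
  change ∫⁻ x, ENNReal.ofReal (klFun (f x)) ∂μ₀ ≤ _
  simp only [← hlim]
  -- Fatou reduces the claim to the bounded test functions log(clip f), for which the hypothesis
  -- already holds.
  refine (lintegral_liminf_le hm).trans (liminf_le_of_frequently_le'
    (Frequently.of_forall fun n => ?_))
  have hui : Integrable (fun x => f x * Real.log (clip n (f x))) μ₀ :=
    (integrable_rnDeriv_smul_iff hac).2 (integrable_of_abs_le (hum n)
      (fun x => abs_log_clip_le n (f x)) q)
  have hci : Integrable (fun x => clip n (f x)) μ₀ :=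
    integrable_of_abs_le (hcm n) (M := (n : ℝ) + 1) (fun x => by
      rw [abs_of_pos (clip_pos n _)]; exact clip_le n _) μ₀
  have hi : Integrable (fun x => f x * Real.log (clip n (f x)) - clip n (f x)) μ₀ := hui.sub hci
  have hi1 : Integrable (fun x => f x * Real.log (clip n (f x)) - clip n (f x) + 1) μ₀ :=
    hi.add (integrable_const 1)
  rw [← ofReal_integral_eq_lintegral_ofReal hi1 (ae_of_all _ fun x => mul_log_clip_nonneg n)]
  refine ENNReal.ofReal_le_ofReal ?_
  rw [integral_add hi (integrable_const 1), integral_sub hui hci]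
  have h1 := integral_le_of_forall_continuous h (hum n) (fun x => abs_log_clip_le n (f x))
  simp only [Real.exp_log (clip_pos n _)] at h1
  have h2 : ∫ x, f x * Real.log (clip n (f x)) ∂μ₀ = ∫ x, Real.log (clip n (f x)) ∂q :=
    integral_rnDeriv_smul hac
  rw [h2]
  simp only [integral_const, probReal_univ, smul_eq_mul, mul_one]
  linarith

end Semicontinuity

/-- By the variational formula the sublevel set is an intersection of half-spaces given by
continuous test functions, each weakly closed. -/
lemma isClosed_relEntropy_le (C : ℝ≥0) :
    IsClosed {q : ProbabilityMeasure UnitAddCircle | relEntropy q ≤ (C : ℝ≥0∞)} := by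
  have : {q : ProbabilityMeasure UnitAddCircle | relEntropy q ≤ (C : ℝ≥0∞)}
      = ⋂ u : BoundedContinuousFunction UnitAddCircle ℝ,
        {q : ProbabilityMeasure UnitAddCircle |
          ∫ x, u x ∂(q : Measure UnitAddCircle) ≤ C + ∫ x, Real.exp (u x) ∂μ₀ - 1} := by
    ext q
    simp only [Set.mem_iInter, Set.mem_ofPred_eq]
    constructor
    · intro hq u
      have hne : relEntropy q ≠ ⊤ := (hq.trans_lt ENNReal.coe_lt_top).ne
      have h1 := integral_le_toReal_klDiv_add hne u.continuous.measurable u.norm_coe_le_norm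
      have h2 : (relEntropy q).toReal ≤ C := ENNReal.toReal_le_coe_of_le_coe hq
      exact h1.trans (sub_le_sub_right (add_le_add_left h2 _) _)
    · intro hq
      exact (klDiv_le_of_forall_continuous hq).trans (by simp)
  rw [this]
  exact isClosed_iInter fun u => isClosed_le
    (ProbabilityMeasure.continuous_integral_boundedContinuousFunction u) continuous_const

/-- The relative entropy is lower semicontinuous for weak convergence. -/
lemma lowerSemicontinuous_relEntropy : LowerSemicontinuous relEntropy := by
  rw [lowerSemicontinuous_iff_isClosed_preimage]
  intro c
  induction c using ENNReal.recTopCoe with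
  | top => simp
  | coe c => exact isClosed_relEntropy_le c

lemma continuous_neg_mul_ereal {K : ℝ} (hK : 0 < K) :
    Continuous fun x : EReal => -((K : EReal) * x) := by
  refine continuous_neg.comp (continuous_iff_continuousAt.2 fun x => ?_)
  have hK0 : (K : EReal) ≠ 0 := by exact_mod_cast hK.ne'
  have h1 : ContinuousAt (fun p : EReal × EReal => p.1 * p.2) ((K : EReal), x) :=
    EReal.continuousAt_mul (Or.inl hK0) (Or.inl hK0) (Or.inl (EReal.coe_ne_bot K))
      (Or.inl (EReal.coe_ne_top K))
  exact h1.comp (f := fun x : EReal => ((K : EReal), x)) (by fun_prop)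

/-- The free energy is lower semicontinuous on measures of bounded entropy. -/
lemma IsInteraction.lowerSemicontinuousOn_freeEnergy {W : UnitAddCircle → ℝ}
    (hW : IsInteraction W) {K : ℝ} (hK : 0 < K) (C : ℝ≥0) :
    LowerSemicontinuousOn (freeEnergy W K) {q | relEntropy q ≤ (C : ℝ≥0∞)} := by
  have hne : ∀ q, relEntropy q ≤ (C : ℝ≥0∞) → relEntropy q ≠ ⊤ :=
    fun q hq => (hq.trans_lt ENNReal.coe_lt_top).ne
  have h1 : LowerSemicontinuousOn (fun q => ((relEntropy q : ℝ≥0∞) : EReal))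
      {q | relEntropy q ≤ (C : ℝ≥0∞)} :=
    (continuous_coe_ennreal_ereal.comp_lowerSemicontinuous lowerSemicontinuous_relEntropy
      (fun _ _ h => EReal.coe_ennreal_le_coe_ennreal_iff.2 h)).lowerSemicontinuousOn _
  have h2 : LowerSemicontinuousOn (fun q => -((K : EReal) * interactionEnergy W q))
      {q | relEntropy q ≤ (C : ℝ≥0∞)} :=
    (continuous_neg_mul_ereal hK).comp_upperSemicontinuousOn_antitone (hW.usc C) fun x y hxy =>
      EReal.neg_le_neg_iff.2 (mul_le_mul_of_nonneg_left hxy (by exact_mod_cast hK.le))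
  have h3 := h1.add' h2 fun q hq => EReal.continuousAt_add
    (Or.inl (by simpa using hne q hq)) (Or.inl (EReal.coe_ennreal_ne_bot _))
  have heq : ∀ q, relEntropy q ≤ (C : ℝ≥0∞) → freeEnergy W K q
      = ((relEntropy q : ℝ≥0∞) : EReal) + -((K : EReal) * interactionEnergy W q) := fun q hq => by
    rw [freeEnergy, if_neg (hne q hq), sub_eq_add_neg]
  intro q hq y hy
  rw [heq q hq] at hy
  filter_upwards [h3 q hq y hy, self_mem_nhdsWithin] with p hp hpC
  rwa [heq p hpC]

/-! ### Existence of global minimizers -/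

namespace IsLogBounded

variable {n : ℕ} {W : UnitAddCircle → ℝ}

/-- Measures of nonpositive free energy have bounded entropy, locally uniformly in `K`. -/
lemma exists_entropy_bound (h : IsLogBounded n W) {L : ℝ} (hL : 0 ≤ L) :
    ∃ C : ℝ≥0, ∀ K, 0 < K → K ≤ L → ∀ q, freeEnergy W K q ≤ 0 → relEntropy q ≤ (C : ℝ≥0∞) := by
  -- Coupling 2L leaves room to absorb: H ≤ K E ≤ L E and 2L E ≤ H + C give 2H ≤ H + C.
  obtain ⟨C, hC⟩ := h.exists_energy_bound ⟨2 * L, by positivity⟩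
  refine ⟨C, fun K hK hKL q hF => ?_⟩
  obtain ⟨hH, e, he, -⟩ := h.exists_energy_of_freeEnergy_lt_top hK (hF.trans_lt EReal.zero_lt_top)
  have h1 := hC q e hH he
  rw [freeEnergy_eq hH he] at hF
  have h2 : (relEntropy q).toReal - K * e ≤ 0 := by exact_mod_cast hF
  have h0 : 0 ≤ (relEntropy q).toReal := ENNReal.toReal_nonneg
  have he0 : 0 ≤ e := by
    by_contra! h4
    nlinarith
  have h3 : (relEntropy q).toReal ≤ C := by
    change 2 * L * e ≤ _ at h1
    nlinarith [mul_le_mul_of_nonneg_right hKL he0]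
  rw [← ENNReal.ofReal_toReal hH]
  exact ENNReal.ofReal_le_of_le_toReal (by simpa using h3)

/-- Existence of global minimizers. -/
lemma exists_isGlobalMinimizer (h : IsLogBounded n W) {K : ℝ} (hK : 0 < K) :
    ∃ q, IsGlobalMinimizer W K q := by
  obtain ⟨C, hC⟩ := h.exists_entropy_bound hK.le
  -- Probability measures on the compact circle form a weakly compact space, so a closed entropy
  -- sublevel set is compact. It contains every competitor of nonpositive free energy.
  obtain ⟨q, hqS, hq⟩ := (h.interaction.lowerSemicontinuousOn_freeEnergy hK C).exists_isMinOn
    ⟨uniformDist, by simp [relEntropy_uniformDist]⟩ (isClosed_relEntropy_le C).isCompact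
  have hq0 : freeEnergy W K q ≤ 0 := by
    rw [← h.freeEnergy_uniformDist K]
    exact hq (by simp [relEntropy_uniformDist])
  refine ⟨q, fun p => ?_⟩
  rcases le_total (freeEnergy W K p) 0 with hp | hp
  · exact hq (hC K hK le_rfl p hp)
  · exact hq0.trans hp

lemma exists_isGlobalMinimizer_ne (h : IsLogBounded n W) {K : ℝ} (hK : 1 < K) :
    ∃ q, q ≠ uniformDist ∧ IsGlobalMinimizer W K q := by
  obtain ⟨q, hq⟩ := h.exists_isGlobalMinimizer (zero_lt_one.trans hK)
  obtain ⟨p, hp⟩ := h.exists_freeEnergy_neg hK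
  refine ⟨q, ?_, hq⟩
  rintro rfl
  have := (hq p).trans_lt hp
  rw [h.freeEnergy_uniformDist] at this
  exact lt_irrefl _ this

end IsLogBounded

/-! ### Pinsker-type inequality and continuity of the transition -/

lemma sqrt_sub_one_sq_le_klFun {x : ℝ} (hx : 0 ≤ x) : (√x - 1) ^ 2 ≤ klFun x := by
  rw [klFun_apply]
  rcases hx.eq_or_lt with rfl | hx
  · simp
  · have hs : 0 < √x := Real.sqrt_pos.2 hx
    have h1 := Real.one_sub_inv_le_log_of_pos hs
    have h2 : Real.log x = 2 * Real.log (√x) := by rw [Real.log_sqrt hx.le]; ring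
    have h3 : x = √x ^ 2 := (Real.sq_sqrt hx.le).symm
    have h4 : x * (1 - (√x)⁻¹) = x - √x := by
      rw [mul_sub, mul_one, ← div_eq_mul_inv, Real.div_sqrt]
    have h5 := mul_le_mul_of_nonneg_left h1 hx.le
    rw [h4] at h5
    rw [h2, sub_sq, ← h3]
    linarith

/-- Factor |x − 1| = |√x − 1|(√x + 1), apply the weighted arithmetic-geometric mean inequality, and
use (√x + 1)² ≤ 2(x + 1). The free parameter t replaces the square root in Pinsker's inequality. -/
lemma abs_sub_one_le_klFun {x t : ℝ} (hx : 0 ≤ x) (ht : 0 < t) :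
    |x - 1| ≤ klFun x / (2 * t) + t * (x + 1) := by
  have h1 := sqrt_sub_one_sq_le_klFun hx
  have hs := Real.sqrt_nonneg x
  have hx2 : √x ^ 2 = x := Real.sq_sqrt hx
  have h2 : |x - 1| = |√x - 1| * (√x + 1) := by
    have h4 : x - 1 = (√x - 1) * (√x + 1) := by linear_combination -hx2
    rw [h4, abs_mul, abs_of_nonneg (by positivity : 0 ≤ √x + 1)]
  have h3 : 2 * t * |x - 1| ≤ klFun x + 2 * t * (t * (x + 1)) := by
    rw [h2]
    have h4 := sq_nonneg (|√x - 1| - t * (√x + 1))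
    have h5 : |√x - 1| ^ 2 = (√x - 1) ^ 2 := sq_abs _
    have h6 : t ^ 2 * (√x + 1) ^ 2 ≤ t ^ 2 * (2 * (x + 1)) := by
      refine mul_le_mul_of_nonneg_left ?_ (sq_nonneg t)
      nlinarith [sq_nonneg (√x - 1)]
    nlinarith
  rw [← sub_le_iff_le_add, le_div_iff₀ (by positivity)]
  linarith

/-- A Pinsker-type inequality: `‖q - q_u‖₁ ≤ H(q | q_u) / (2 t) + 2 t` for every `t > 0`. -/
lemma l1DistUniform_le {q : ProbabilityMeasure UnitAddCircle} (hH : relEntropy q ≠ ⊤) {t : ℝ}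
    (ht : 0 < t) :
    l1DistUniform q ≤ ENNReal.ofReal ((relEntropy q).toReal / (2 * t) + 2 * t) := by
  set f : UnitAddCircle → ℝ := fun θ => ((q : Measure UnitAddCircle).rnDeriv μ₀ θ).toReal with hf
  obtain ⟨hac, hint⟩ := klDiv_ne_top_iff.1 hH
  have hac' : (q : Measure UnitAddCircle) ≪ μ₀ := hac
  have hfi : Integrable f μ₀ := Measure.integrable_toReal_rnDeriv
  have hk : Integrable (fun θ => klFun (f θ)) μ₀ := (integrable_klFun_rnDeriv_iff hac).2 hint
  have hf1 : ∫ θ, f θ ∂μ₀ = 1 := by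
    rw [hf, Measure.integral_toReal_rnDeriv hac']
    simp
  have hd : Integrable (fun θ => f θ - 1) μ₀ := hfi.sub (integrable_const 1)
  have h1 : l1DistUniform q = ENNReal.ofReal (∫ θ, ‖f θ - 1‖ ∂μ₀) := by
    rw [ofReal_integral_norm_eq_lintegral_enorm hd, l1DistUniform, eLpNorm_one_eq_lintegral_enorm]
    rfl
  rw [h1]
  refine ENNReal.ofReal_le_ofReal ?_
  have hb : Integrable (fun θ => klFun (f θ) / (2 * t) + t * (f θ + 1)) μ₀ :=
    (hk.div_const _).add ((hfi.add (integrable_const 1)).const_mul _)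
  have hkl : (relEntropy q).toReal = ∫ θ, klFun (f θ) ∂μ₀ := toReal_klDiv_eq_integral_klFun hac
  calc ∫ θ, ‖f θ - 1‖ ∂μ₀ ≤ ∫ θ, (klFun (f θ) / (2 * t) + t * (f θ + 1)) ∂μ₀ :=
        integral_mono hd.norm hb fun θ => abs_sub_one_le_klFun ENNReal.toReal_nonneg ht
    _ = (relEntropy q).toReal / (2 * t) + 2 * t := by
        have hf2 : Integrable (fun θ => f θ + 1) μ₀ := hfi.add (integrable_const 1)
        rw [integral_add (hk.div_const _) (hf2.const_mul _), integral_div, integral_const_mul,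
          integral_add hfi (integrable_const 1), hf1, hkl]
        simp
        ring

namespace IsLogBounded

variable {n : ℕ} {W : UnitAddCircle → ℝ}

/-- The energy of global minimizers tends to `0` at the critical coupling. -/
lemma eventually_energy_lt (h : IsLogBounded n W) {q : ℝ → ProbabilityMeasure UnitAddCircle}
    (hq : ∀ K, 1 < K → IsGlobalMinimizer W K (q K)) {ε : ℝ} (hε : 0 < ε) :
    ∀ᶠ K in 𝓝[>] (1 : ℝ), interactionEnergy W (q K) < ε := by
  obtain ⟨C, hC⟩ := h.exists_entropy_bound (zero_le_two (α := ℝ))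
  have hF : ∀ K, 1 < K → freeEnergy W K (q K) ≤ 0 := fun K hK => by
    rw [← h.freeEnergy_uniformDist K]; exact hq K hK uniformDist
  set S : Set (ProbabilityMeasure UnitAddCircle) := {q | relEntropy q ≤ (C : ℝ≥0∞)} with hS
  have hle2 : ∀ᶠ K in 𝓝[>] (1 : ℝ), K ≤ 2 :=
    eventually_nhdsWithin_of_eventually_nhds (eventually_le_nhds one_lt_two)
  have hqS : ∀ᶠ K in 𝓝[>] (1 : ℝ), q K ∈ S := by
    filter_upwards [hle2, self_mem_nhdsWithin] with K hK2 hK1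
    exact hC K (zero_lt_one.trans hK1) hK2 _ (hF K hK1)
  by_contra hcon
  have hfreq : ∃ᶠ K in 𝓝[>] (1 : ℝ), (ε : EReal) ≤ interactionEnergy W (q K) :=
    (not_eventually.1 hcon).mono fun K hK => not_lt.1 hK
  -- If the claim failed, couplings with energy at least ε would accumulate at 1. Compactness gives
  -- a cluster point x of their minimizers; semicontinuity yields E(x) ≥ ε and F_1(x) ≤ 0, which is
  -- impossible.
  set l : Filter ℝ := 𝓝[>] (1 : ℝ) ⊓ 𝓟 {K | (ε : EReal) ≤ interactionEnergy W (q K)} with hl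
  have hlne : l.NeBot := frequently_mem_iff_neBot.1 hfreq
  have hll : l ≤ 𝓝[>] (1 : ℝ) := inf_le_left
  have hmap : map q l ≤ 𝓟 S := by
    rw [le_principal_iff]
    exact hll hqS
  obtain ⟨x, hxS, hx⟩ := (isClosed_relEntropy_le C).isCompact hmap
  have hxne : (𝓝 x ⊓ map q l).NeBot := hx
  have hwithin : 𝓝 x ⊓ map q l ≤ 𝓝[S] x := inf_le_inf_left _ hmap
  have hxE : (ε : EReal) ≤ interactionEnergy W x := by
    by_contra! hlt
    have h1 : ∀ᶠ z in 𝓝 x ⊓ map q l, interactionEnergy W z < ε :=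
      hwithin (h.interaction.usc C x hxS ε hlt)
    have h2 : ∀ᶠ z in map q l, (ε : EReal) ≤ interactionEnergy W z :=
      (inf_le_right : l ≤ _) (mem_principal_self _)
    obtain ⟨z, hz1, hz2⟩ := (h1.and (h2.filter_mono inf_le_right)).exists
    exact absurd hz2 (not_le.2 hz1)
  have hxF : ∀ δ : ℝ, 0 < δ → freeEnergy W 1 x ≤ δ := by
    intro δ hδ
    by_contra! hlt
    have h1 : ∀ᶠ z in 𝓝 x ⊓ map q l, (δ : EReal) < freeEnergy W 1 z :=
      hwithin (h.interaction.lowerSemicontinuousOn_freeEnergy one_pos C x hxS δ hlt)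
    have hsmall : ∀ᶠ K in 𝓝[>] (1 : ℝ), (K - 1) * C < δ := by
      refine eventually_nhdsWithin_of_eventually_nhds ?_
      have : ContinuousAt (fun K : ℝ => (K - 1) * C) 1 := by fun_prop
      exact this.eventually_lt_const (by simpa using hδ)
    -- F_1(q_K) = F_K(q_K) + (K − 1)E(q_K), where the first term is nonpositive and E ≤ H ≤ C.
    have h2 : ∀ᶠ z in map q l, freeEnergy W 1 z ≤ δ := by
      refine hll ?_
      filter_upwards [hsmall, hqS, self_mem_nhdsWithin] with K hK hKS hK1
      obtain ⟨hH, e, he, hle⟩ := h.exists_energy_of_freeEnergy_lt_top (zero_lt_one.trans hK1)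
        ((hF K hK1).trans_lt EReal.zero_lt_top)
      have h3 := hF K hK1
      rw [freeEnergy_eq hH he] at h3
      have h4 : (relEntropy (q K)).toReal - K * e ≤ 0 := by exact_mod_cast h3
      have h5 : (relEntropy (q K)).toReal ≤ C := ENNReal.toReal_le_coe_of_le_coe hKS
      change freeEnergy W 1 (q K) ≤ δ
      rw [freeEnergy_eq hH he, EReal.coe_le_coe_iff]
      have h6 : (K - 1) * e ≤ (K - 1) * C :=
        mul_le_mul_of_nonneg_left (hle.trans h5) (sub_nonneg.2 (le_of_lt hK1))
      linarith
    obtain ⟨z, hz1, hz2⟩ := (h1.and (h2.filter_mono inf_le_right)).exists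
    exact absurd hz2 (not_le.2 hz1)
  have hx0 : freeEnergy W 1 x ≤ 0 := by
    by_contra! hpos
    obtain ⟨δ, hδ0, hδ⟩ := EReal.lt_iff_exists_real_btwn.1 hpos
    exact absurd (hxF δ (by exact_mod_cast hδ0)) (not_le.2 hδ)
  rw [h.eq_uniformDist_of_freeEnergy_nonpos zero_le_one le_rfl hx0,
    h.interactionEnergy_uniformDist] at hxE
  exact absurd hxE (not_le.2 (by exact_mod_cast hε))

lemma tendsto_l1DistUniform (h : IsLogBounded n W) {q : ℝ → ProbabilityMeasure UnitAddCircle}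
    (hq : ∀ K, 1 < K → IsGlobalMinimizer W K (q K)) :
    Tendsto (fun K => l1DistUniform (q K)) (𝓝[>] (1 : ℝ)) (𝓝 0) := by
  rw [ENNReal.tendsto_nhds_zero]
  intro ε hε
  obtain ⟨δ, hδ0, hδε⟩ : ∃ δ : ℝ, 0 < δ ∧ ENNReal.ofReal δ ≤ ε := by
    rcases eq_or_ne ε ⊤ with rfl | hne
    · exact ⟨1, one_pos, le_top⟩
    · exact ⟨ε.toReal, ENNReal.toReal_pos hε.ne' hne, ENNReal.ofReal_toReal_le⟩
  -- E < 2t² and K ≤ 2 give H ≤ 4t², so the Pinsker-type bound H/(2t) + 2t is at most 4t = δ.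
  set t : ℝ := δ / 4 with ht
  have ht0 : 0 < t := by positivity
  have hle2 : ∀ᶠ K in 𝓝[>] (1 : ℝ), K ≤ 2 :=
    eventually_nhdsWithin_of_eventually_nhds (eventually_le_nhds one_lt_two)
  filter_upwards [h.eventually_energy_lt hq (ε := 2 * t ^ 2) (by positivity), hle2,
    self_mem_nhdsWithin] with K hKE hK2 hK1
  have hF : freeEnergy W K (q K) ≤ 0 := by
    rw [← h.freeEnergy_uniformDist K]; exact hq K hK1 uniformDist
  have hK1' : 1 < K := hK1
  obtain ⟨hH, e, he, hle⟩ := h.exists_energy_of_freeEnergy_lt_top (zero_lt_one.trans hK1')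
    (hF.trans_lt EReal.zero_lt_top)
  rw [freeEnergy_eq hH he] at hF
  have h4 : (relEntropy (q K)).toReal - K * e ≤ 0 := by exact_mod_cast hF
  rw [he, EReal.coe_lt_coe_iff] at hKE
  have h0 : 0 ≤ (relEntropy (q K)).toReal := ENNReal.toReal_nonneg
  have he0 : 0 ≤ e := by
    by_contra! h5
    nlinarith
  refine (l1DistUniform_le hH ht0).trans (le_trans (ENNReal.ofReal_le_ofReal ?_) hδε)
  have h6 : (relEntropy (q K)).toReal ≤ 4 * t ^ 2 := by nlinarith
  have h7 : (relEntropy (q K)).toReal / (2 * t) ≤ 2 * t := by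
    rw [div_le_iff₀ (by positivity)]
    linarith
  linarith

lemma isContinuousTransition (h : IsLogBounded n W) : IsContinuousTransition W 1 := by
  obtain ⟨h1, h2⟩ := h.isUniqueGlobalMinimizer_uniformDist zero_le_one le_rfl
  exact ⟨⟨uniformDist, h1, h2⟩, fun q hq => (h.tendsto_l1DistUniform hq).limsup_eq⟩

lemma isCriticalCoupling (h : IsLogBounded n W) : IsCriticalCoupling W 1 where
  pos := one_pos
  subcritical _ hK0 hK1 := h.isUniqueGlobalMinimizer_uniformDist hK0 hK1.le
  critical := (h.isUniqueGlobalMinimizer_uniformDist zero_le_one le_rfl).1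
  supercritical _ hK := h.exists_isGlobalMinimizer_ne hK

lemma isUniqueGlobalMinimizer_iff (h : IsLogBounded n W) {K : ℝ} (hK : 0 ≤ K) :
    IsUniqueGlobalMinimizer W K uniformDist ↔ K ≤ 1 := by
  refine ⟨fun hmin => ?_, h.isUniqueGlobalMinimizer_uniformDist hK⟩
  by_contra! hK1
  obtain ⟨q, hq1, hq2⟩ := h.exists_isGlobalMinimizer_ne hK1
  exact hq1 (hmin.2 q hq2)

lemma isLinearStabilityThreshold (h : IsLogBounded n W) : IsLinearStabilityThreshold W 1 := by
  refine ⟨1 / 2, ⟨⟨n + 1, by omega, ?_, ?_⟩, ?_⟩, by norm_num⟩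
  · have := h.norm
    push_cast
    linarith
  · have := h.norm
    push_cast
    linarith
  · rintro _ ⟨k, hk1, hk2, rfl⟩
    have hd : ((n : ℤ) + 1) ∣ k := by
      by_contra hd
      rw [h.WHat_eq_zero hd] at hk2
      exact lt_irrefl _ hk2
    have hle : n + 1 ≤ k := Nat.le_of_dvd hk1 (by exact_mod_cast hd)
    have h1 := h.decay k hk1
    have hk0 : (0 : ℝ) < k := by exact_mod_cast hk1
    have h2 : ((n : ℝ) + 1) / k ≤ 1 := by
      rw [div_le_one hk0]
      exact_mod_cast hle
    linarith

/-! ### Critical points at weak coupling -/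

section CriticalPoints

lemma stronglyMeasurable_convMeasure (hW : Measurable W) (q : ProbabilityMeasure UnitAddCircle) :
    StronglyMeasurable (convMeasure W q) :=
  StronglyMeasurable.integral_prod_right' (f := fun p : UnitAddCircle × UnitAddCircle =>
    W (p.1 - p.2)) (hW.comp (measurable_fst.sub measurable_snd)).stronglyMeasurable

lemma integrable_convMeasure (hW : IsInteraction W) (q : ProbabilityMeasure UnitAddCircle) :
    Integrable (convMeasure W q) μ₀ ∧ ∫ θ, convMeasure W q θ ∂μ₀ = 0 := by
  have hi := integrable_comp_sub_prod hW.measurable hW.integrable (q : Measure UnitAddCircle)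
  refine ⟨hi.integral_prod_left, ?_⟩
  have h1 : ∫ θ, convMeasure W q θ ∂μ₀
      = ∫ y, ∫ x, W (x - y) ∂μ₀ ∂(q : Measure UnitAddCircle) := integral_integral_swap hi
  have h2 : ∀ y : UnitAddCircle, ∫ x, W (x - y) ∂μ₀ = 0 := fun y => by
    rw [integral_sub_right_eq_self W y]
    exact hW.mean_zero
  rw [h1]
  simp [h2]

lemma convMeasure_uniformDist (hW : IsInteraction W) (θ : UnitAddCircle) :
    convMeasure W uniformDist θ = 0 := by
  change ∫ y, W (θ - y) ∂μ₀ = 0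
  rw [integral_sub_left_eq_self W μ₀ θ]
  exact hW.mean_zero

lemma isCriticalPoint_uniformDist (h : IsLogBounded n W) (K : ℝ) :
    IsCriticalPoint W K uniformDist := by
  refine ⟨by rw [h.freeEnergy_uniformDist]; exact EReal.zero_lt_top, ?_, ?_⟩
  · simp only [convMeasure_uniformDist h.interaction, mul_zero, Real.exp_zero]
    exact integrable_const _
  · simp [convMeasure_uniformDist h.interaction]

/-- The mean of `W * q` under `q` is the interaction energy of `q`. -/
lemma integral_convMeasure_self (h : IsLogBounded n W) {q : ProbabilityMeasure UnitAddCircle}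
    {e : ℝ} (he : interactionEnergy W q = e) :
    Integrable (convMeasure W q) (q : Measure UnitAddCircle) ∧
      ∫ θ, convMeasure W q θ ∂(q : Measure UnitAddCircle) = e := by
  have hmeas : Measurable fun p : UnitAddCircle × UnitAddCircle => W (p.1 - p.2) :=
    h.interaction.measurable.comp (measurable_fst.sub measurable_snd)
  have hneg := lintegral_neg_part_ne_top (W := W) (q := q) (by rw [he]; exact EReal.coe_ne_bot e)
  have hpos : ∫⁻ p, ENNReal.ofReal (W (p.1 - p.2))
      ∂((q : Measure UnitAddCircle).prod (q : Measure UnitAddCircle)) ≠ ⊤ := by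
    intro htop
    rw [interactionEnergy, htop, ← EReal.coe_ennreal_toReal hneg] at he
    simp at he
  have hint : Integrable (fun p : UnitAddCircle × UnitAddCircle => W (p.1 - p.2))
      ((q : Measure UnitAddCircle).prod (q : Measure UnitAddCircle)) := by
    refine ⟨hmeas.aestronglyMeasurable, ?_⟩
    have h1 : ∀ p : UnitAddCircle × UnitAddCircle, ‖W (p.1 - p.2)‖ₑ
        = ENNReal.ofReal (W (p.1 - p.2)) + ENNReal.ofReal (-W (p.1 - p.2)) := by
      intro p
      rw [Real.enorm_eq_ofReal_abs]
      rcases le_total 0 (W (p.1 - p.2)) with h0 | h0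
      · rw [abs_of_nonneg h0, ENNReal.ofReal_of_nonpos (neg_nonpos.2 h0), add_zero]
      · rw [abs_of_nonpos h0, ENNReal.ofReal_of_nonpos h0, zero_add]
    rw [hasFiniteIntegral_iff_enorm]
    simp only [h1]
    rw [lintegral_add_left hmeas.ennreal_ofReal]
    exact ENNReal.add_lt_top.2 ⟨hpos.lt_top, hneg.lt_top⟩
  refine ⟨hint.integral_prod_left, ?_⟩
  rw [interactionEnergy_eq_integral hint, EReal.coe_eq_coe_iff, integral_prod _ hint] at he
  exact he

lemma eq_uniformDist_of_isCriticalPoint (h : IsLogBounded n W) {K : ℝ} (hK0 : 0 < K)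
    (hK : K ≤ 1 / 2) {q : ProbabilityMeasure UnitAddCircle} (hq : IsCriticalPoint W K q) :
    q = uniformDist := by
  obtain ⟨hF, hexp, hdens⟩ := hq
  obtain ⟨hH, e, he, hle⟩ := h.exists_energy_of_freeEnergy_lt_top hK0 hF
  have hac : (q : Measure UnitAddCircle) ≪ μ₀ := (klDiv_ne_top_iff.1 hH).1
  obtain ⟨hconvint, hconv⟩ := integrable_convMeasure h.interaction q
  obtain ⟨hself, hselfe⟩ := h.integral_convMeasure_self he
  set u : UnitAddCircle → ℝ := fun θ => 2 * K * convMeasure W q θ with hu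
  have hexp' : Integrable (fun θ => Real.exp (u θ)) μ₀ := hexp
  set Z : ℝ := ∫ θ, Real.exp (u θ) ∂μ₀ with hZ
  have hZpos : 0 < Z := integral_exp_pos hexp'
  have hdens' : (q : Measure UnitAddCircle) = Measure.withDensity μ₀ fun θ =>
    ENNReal.ofReal (Real.exp (u θ) / Z) := hdens
  have hum : Measurable u :=
    (stronglyMeasurable_convMeasure h.interaction.measurable q).measurable.const_mul _
  have hui : Integrable u μ₀ := hconvint.const_mul _
  have hu0 : ∫ θ, u θ ∂μ₀ = 0 := by rw [hu, integral_const_mul, hconv, mul_zero]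
  have hllr : llr (q : Measure UnitAddCircle) μ₀ =ᵐ[(q : Measure UnitAddCircle)]
      fun θ => u θ - Real.log Z := by
    have h1 := Measure.rnDeriv_withDensity μ₀
      (ENNReal.measurable_ofReal.comp (hum.exp.div_const Z))
    rw [Function.comp_def, ← hdens'] at h1
    filter_upwards [hac.ae_le h1] with θ hθ
    rw [llr, hθ, ENNReal.toReal_ofReal (by positivity), Real.log_div (Real.exp_ne_zero _) hZpos.ne',
      Real.log_exp]
  have hent : (relEntropy q).toReal = 2 * K * e - Real.log Z := by
    have h1 : (relEntropy q).toReal = ∫ θ, llr (q : Measure UnitAddCircle) μ₀ θ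
        ∂(q : Measure UnitAddCircle) := toReal_klDiv_of_measure_eq hac (by simp)
    rw [h1, integral_congr_ae hllr, integral_sub (hself.const_mul _) (integrable_const _),
      integral_const_mul, hselfe]
    simp
  -- log Z = 2K E − H. If E ≥ 0, then 2K E ≤ E ≤ H; if E ≤ 0, then 2K E ≤ 0 ≤ H.
  have hlogZ : Real.log Z ≤ 0 := by
    have h0 : 0 ≤ (relEntropy q).toReal := ENNReal.toReal_nonneg
    rcases le_total 0 e with he0 | he0 <;> nlinarith
  have hZ1 : Z ≤ 1 := (Real.log_nonpos_iff hZpos.le).1 hlogZ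
  have hgi : Integrable (fun θ => Real.exp (u θ) - (u θ + 1)) μ₀ :=
    hexp'.sub (hui.add (integrable_const 1))
  have hg0 : ∀ θ, 0 ≤ Real.exp (u θ) - (u θ + 1) := fun θ => sub_nonneg.2 (Real.add_one_le_exp _)
  have hgint : ∫ θ, (Real.exp (u θ) - (u θ + 1)) ∂μ₀ = Z - 1 := by
    have hu1 : Integrable (fun θ => u θ + 1) μ₀ := hui.add (integrable_const 1)
    rw [integral_sub hexp' hu1, integral_add hui (integrable_const 1), hu0]
    simp [hZ]
  -- The integral of the nonnegative function exp u − u − 1 equals Z − 1 ≤ 0, so the function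
  -- vanishes almost everywhere; strict convexity of exp then gives u = 0.
  have hgz : ∫ θ, (Real.exp (u θ) - (u θ + 1)) ∂μ₀ = 0 :=
    le_antisymm (by rw [hgint]; linarith) (integral_nonneg hg0)
  have hu_ae : ∀ᵐ θ ∂μ₀, u θ = 0 := by
    filter_upwards [(integral_eq_zero_iff_of_nonneg hg0 hgi).1 hgz] with θ hθ
    by_contra hne
    have h1 := Real.add_one_lt_exp hne
    have h2 : Real.exp (u θ) - (u θ + 1) = 0 := hθ
    linarith
  have hZeq : Z = 1 := by linarith [hgint, hgz]
  refine Subtype.ext ?_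
  change (q : Measure UnitAddCircle) = μ₀
  rw [hdens']
  have : (fun θ => ENNReal.ofReal (Real.exp (u θ) / Z)) =ᵐ[μ₀] 1 := by
    filter_upwards [hu_ae] with θ hθ
    simp [hθ, hZeq]
  rw [withDensity_congr_ae this, withDensity_one]

lemma isCriticalPoint_iff (h : IsLogBounded n W) {K : ℝ} (hK0 : 0 ≤ K) (hK : K ≤ 1 / 2)
    (q : ProbabilityMeasure UnitAddCircle) : IsCriticalPoint W K q ↔ q = uniformDist := by
  constructor
  · intro hq
    -- For K = 0 the exponent vanishes identically and the equation itself says that q has density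
    -- 1.
    rcases hK0.eq_or_lt with rfl | hK0
    · refine Subtype.ext (hq.2.2.trans ?_)
      simp
    · exact h.eq_uniformDist_of_isCriticalPoint hK0 hK hq
  · rintro rfl
    exact h.isCriticalPoint_uniformDist K

end CriticalPoints

end IsLogBounded

end

theorem theorem1p1 (n : ℕ) (W : UnitAddCircle → ℝ) (hW : IsInteraction W)
    (hper : Function.Periodic W ((1 / ((n : ℝ) + 1) : ℝ) : UnitAddCircle))
    (hnorm : 2 * WHat W ((n : ℤ) + 1) = 1)
    (hdecay : ∀ k : ℕ, 1 ≤ k → 2 * WHat W k ≤ ((n : ℝ) + 1) / k) :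
    (∀ K : ℝ, 0 ≤ K → (IsUniqueGlobalMinimizer W K uniformDist ↔ K ≤ 1)) ∧
    IsCriticalCoupling W 1 ∧
    IsLinearStabilityThreshold W 1 ∧
    IsContinuousTransition W 1 ∧
    (∀ K : ℝ, 0 ≤ K → K ≤ 1 / 2 →
      ∀ q : ProbabilityMeasure UnitAddCircle, IsCriticalPoint W K q ↔ q = uniformDist) := by
  have h : IsLogBounded n W := ⟨hW, hper, hnorm, hdecay⟩
  exact ⟨fun K hK => h.isUniqueGlobalMinimizer_iff hK, h.isCriticalCoupling,
    h.isLinearStabilityThreshold, h.isContinuousTransition,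
    fun K hK0 hK q => h.isCriticalPoint_iff hK0 hK q⟩
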